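/- Let $\mathbb F$ be a field and let $[0,\infty]^2=[0,\infty]\times[0,\infty]$ carry the product order, regarded as a category. Write $\mathsf{Vec}_{\mathbb F}$ for the category of $\mathbb F$-vector spaces. A functor $F\colon[0,\infty]^2\to\mathsf{Vec}_{\mathbb F}$ is *p.f.d.* if every $F(x)$ is finite-dimensional. It is *codegree 1* (resp. *degree 1*) if it sends every square in $[0,\infty]^2$ that is both a pullback and a pushout square to a pushout (resp. pullback) square of vector spaces; that is, if it takes strongly bicartesian 2-cubes to cocartesian (resp. cartesian) 2-cubes. An *interval* in a poset $P$ is a nonempty subset $I\subseteq P$ such that $x\le z\le y$ with $x,y\in I$ implies $z\in I$, and such that any two points of $I$ are connected by a zigzag of order relations within $I$. The *interval module* $\mathbb F_I$ is the functor $P\to\mathsf{Vec}_{\mathbb F}$ with $\mathbb F_I(x)=\mathbb F$ for $x\in I$ and $\mathbb F_I(x)=0$ for $x\notin I$, whose structure map for $x\le y$ is the identity if $x,y\in I$ and zero otherwise. An interval $I\subseteq[0,\infty]^2$ is - a *death block* if $I=J_1\times J_2$ with $J_1,J_2\subseteq[0,\infty]$ down-closed; - a *birth block* if $I=J_1\times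 J_2$ with $J_1,J_2\subseteq[0,\infty]$ up-closed; - a *vertical block* if $I=J\times[0,\infty]$ for an interval $J\subseteq[0,\infty]$; - a *horizontal block* if $I=[0,\infty]\times J$ for an interval $J\subseteq[0,\infty]$. **Proposition.** Let $F\colon[0,\infty]^2\to\mathsf{Vec}_{\mathbb F}$ be a p.f.d. functor. 1. If $F$ is codegree 1, then $F$ is isomorphic to a direct sum of interval modules (repetitions allowed), each over a death block, a vertical block or a horizontal block. 2. Dually, if $F$ is degree 1, then $F$ is isomorphic to a direct sum of interval modules (repetitions allowed), each over a birth block, a vertical block or a horizontal block. -/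

import Mathlib

open CategoryTheory CategoryTheory.Limits
open scoped ENNReal

universe u v w

/-! ### Cubical diagrams -/

/-- A `k`-cube in `C`: a functor from the power set of a `k`-element set, ordered by inclusion. -/
abbrev Cube (k : ℕ) (C : Type u) [Category.{v} C] := Finset (Fin k) ⥤ C

namespace Cube

variable {k : ℕ} {C : Type u} [Category.{v} C]

/-- For `S ⊆ T`, the face of `X` on `{U | S ⊆ U ⊆ T}` (a cube of dimension `#(T \ S)`), with its
terminal vertex removed. -/
@[simps]
def lowerFace (X : Cube k C) (S T : Finset (Fin k)) :
    {U : Finset (Fin k) // S ≤ U ∧ U < T} ⥤ C where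
  obj U := X.obj U.1
  map f := X.map (homOfLE (leOfHom f))
  map_id _ := X.map_id _
  map_comp _ _ := X.map_comp _ _

/-- For `S ⊆ T`, the face of `X` on `{U | S ⊆ U ⊆ T}`, with its initial vertex removed. -/
@[simps]
def upperFace (X : Cube k C) (S T : Finset (Fin k)) :
    {U : Finset (Fin k) // S < U ∧ U ≤ T} ⥤ C where
  obj U := X.obj U.1
  map f := X.map (homOfLE (leOfHom f))
  map_id _ := X.map_id _
  map_comp _ _ := X.map_comp _ _

/-- The canonical cocone on the face from `S` to `T` with its terminal vertex `X(T)` as point. -/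
@[simps]
def faceCocone (X : Cube k C) (S T : Finset (Fin k)) : Cocone (X.lowerFace S T) where
  pt := X.obj T
  ι :=
    { app := fun U => X.map (homOfLE U.2.2.le)
      naturality := fun U V f => by
        exact (X.map_comp _ _).symm.trans (Category.comp_id _).symm }

/-- The canonical cone on the face from `S` to `T` with its initial vertex `X(S)` as point. -/
@[simps]
def faceCone (X : Cube k C) (S T : Finset (Fin k)) : Cone (X.upperFace S T) where
  pt := X.obj S
  π :=
    { app := fun U => X.map (homOfLE U.2.1.le)
      naturality := fun U V f => by
        exact (Category.id_comp _).trans (X.map_comp _ _) }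

/-- The face of `X` from `S` to `T` is cocartesian: `colim_{S ⊆ U ⊊ T} X(U) → X(T)` is an
isomorphism. -/
def IsCocartesianFace (X : Cube k C) (S T : Finset (Fin k)) : Prop :=
  Nonempty (IsColimit (X.faceCocone S T))

/-- The face of `X` from `S` to `T` is cartesian: `X(S) → lim_{S ⊊ U ⊆ T} X(U)` is an
isomorphism. -/
def IsCartesianFace (X : Cube k C) (S T : Finset (Fin k)) : Prop :=
  Nonempty (IsLimit (X.faceCone S T))

/-- `X` is cocartesian: the canonical map `colim_{U ≠ univ} X(U) → X(univ)` is an isomorphism. -/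
def IsCocartesian (X : Cube k C) : Prop := X.IsCocartesianFace ∅ Finset.univ

/-- `X` is cartesian: the canonical map `X(∅) → lim_{U ≠ ∅} X(U)` is an isomorphism. -/
def IsCartesian (X : Cube k C) : Prop := X.IsCartesianFace ∅ Finset.univ

/-- Every face of dimension at least two is both cartesian and cocartesian. -/
def IsStronglyBicartesian (X : Cube k C) : Prop :=
  ∀ S T : Finset (Fin k), S ⊆ T → 2 ≤ (T \ S).card →
    X.IsCartesianFace S T ∧ X.IsCocartesianFace S T

end Cube

/-! ### Degree and codegree of functors on a distributive lattice -/

/-- `F` takes strongly bicartesian `(n+1)`-cubes in the lattice `P` (seen as a category) to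
cocartesian `(n+1)`-cubes. -/
def IsCodegree {P : Type w} [DistribLattice P] {C : Type u} [Category.{v} C] (n : ℕ)
    (F : P ⥤ C) : Prop :=
  ∀ X : Cube (n + 1) P, X.IsStronglyBicartesian → Cube.IsCocartesian (X ⋙ F)

/-- `F` takes strongly bicartesian `(n+1)`-cubes in the lattice `P` (seen as a category) to
cartesian `(n+1)`-cubes. -/
def IsDegree {P : Type w} [DistribLattice P] {C : Type u} [Category.{v} C] (n : ℕ)
    (F : P ⥤ C) : Prop :=
  ∀ X : Cube (n + 1) P, X.IsStronglyBicartesian → Cube.IsCartesian (X ⋙ F)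

/-! ### Persistence modules -/

/-- Functors from the poset `P` to vector spaces over `𝕜`. (The category structure on `P` is the
one given by its order, also when `P` is a product.) -/
abbrev PersistenceModule (𝕜 : Type u) [Field 𝕜] (P : Type w) [PartialOrder P] :=
  P ⥤ ModuleCat.{u} 𝕜

/-- Pointwise finite-dimensional. -/
def PersistenceModule.IsPFD {𝕜 : Type u} [Field 𝕜] {P : Type w} [PartialOrder P]
    (F : PersistenceModule 𝕜 P) : Prop :=
  ∀ x : P, FiniteDimensional 𝕜 (F.obj x)

/-- An interval in a poset: a nonempty convex subset, any two points of which are joined by a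
zigzag of order relations inside the subset. -/
structure IsPosetInterval {P : Type w} [PartialOrder P] (I : Set P) : Prop where
  nonempty : I.Nonempty
  convex : ∀ ⦃x y z : P⦄, x ∈ I → y ∈ I → x ≤ z → z ≤ y → z ∈ I
  connected : ∀ ⦃x y : P⦄, x ∈ I → y ∈ I →
    Relation.ReflTransGen (fun a b => a ∈ I ∧ b ∈ I ∧ (a ≤ b ∨ b ≤ a)) x y

section IntervalModule

variable (𝕜 : Type u) [Field 𝕜] {P : Type w} [PartialOrder P]

open Classical in
/-- The value at `x` of the interval module over `I`: all of `𝕜` if `x ∈ I`, and zero otherwise. -/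
noncomputable def intervalStalk (I : Set P) (x : P) : Submodule 𝕜 𝕜 :=
  if x ∈ I then ⊤ else ⊥

open Classical in
/-- The structure map of the interval module: the identity of `𝕜` if `x, y ∈ I`, and zero
otherwise. -/
noncomputable def intervalMap (I : Set P) (x y : P) :
    intervalStalk 𝕜 I x →ₗ[𝕜] intervalStalk 𝕜 I y :=
  if h : x ∈ I ∧ y ∈ I then
    Submodule.inclusion (by simp [intervalStalk, h.1, h.2])
  else 0

/-- The interval module over an interval `I`. -/
noncomputable def intervalModule (I : Set P) (hI : IsPosetInterval I) : PersistenceModule 𝕜 P where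
  obj x := ModuleCat.of 𝕜 (intervalStalk 𝕜 I x)
  map {x y} _ := ModuleCat.ofHom (intervalMap 𝕜 I x y)
  map_id x := by
    ext c
    by_cases hx : x ∈ I
    · simp [intervalMap, hx]
    · have : (c : 𝕜) = 0 := by
        have := c.2
        simpa [intervalStalk, hx] using this
      simp [intervalMap, hx, this]
  map_comp {x y z} f g := by
    ext c
    by_cases hx : x ∈ I <;> by_cases hz : z ∈ I
    · have hy : y ∈ I := hI.convex hx hz (leOfHom f) (leOfHom g)
      simp [intervalMap, hx, hy, hz]
    all_goals simp [intervalMap, hx, hz]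

end IntervalModule

/-- `F` is isomorphic to a direct sum of interval modules over intervals satisfying `B` (with
repetitions allowed). The direct sum is the coproduct in the category of persistence modules. -/
def PersistenceModule.IsIntervalDecomposableOver {𝕜 : Type u} [Field 𝕜] {P : Type w}
    [PartialOrder P] (F : PersistenceModule 𝕜 P) (B : Set P → Prop) : Prop :=
  ∃ (ι : Type w) (I : ι → Set P) (hI : ∀ i, IsPosetInterval (I i))
    (c : Cofan fun i => intervalModule 𝕜 (I i) (hI i)),
    (∀ i, B (I i)) ∧ Nonempty (IsColimit c) ∧ Nonempty (F ≅ c.pt)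

/-! ### Blocks in `[0,∞]²` -/

/-- A product of two down-closed subsets of `[0,∞]`. -/
def IsDeathBlock (I : Set (ℝ≥0∞ × ℝ≥0∞)) : Prop :=
  IsPosetInterval I ∧ ∃ J₁ J₂ : Set ℝ≥0∞, IsLowerSet J₁ ∧ IsLowerSet J₂ ∧ I = J₁ ×ˢ J₂

/-- A product of two up-closed subsets of `[0,∞]`. -/
def IsBirthBlock (I : Set (ℝ≥0∞ × ℝ≥0∞)) : Prop :=
  IsPosetInterval I ∧ ∃ J₁ J₂ : Set ℝ≥0∞, IsUpperSet J₁ ∧ IsUpperSet J₂ ∧ I = J₁ ×ˢ J₂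

/-- `J × [0,∞]` for an interval `J`. -/
def IsVerticalBlock (I : Set (ℝ≥0∞ × ℝ≥0∞)) : Prop :=
  IsPosetInterval I ∧ ∃ J : Set ℝ≥0∞, IsPosetInterval J ∧ I = J ×ˢ Set.univ

/-- `[0,∞] × J` for an interval `J`. -/
def IsHorizontalBlock (I : Set (ℝ≥0∞ × ℝ≥0∞)) : Prop :=
  IsPosetInterval I ∧ ∃ J : Set ℝ≥0∞, IsPosetInterval J ∧ I = Set.univ ×ˢ J

/-! ### Linear algebra -/

section LinearAlgebra

variable {𝕜 : Type*} [Field 𝕜]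

/-- A functional that kills the kernel of `f` factors through `f`. -/
theorem LinearMap.exists_comp_eq_of_ker_le {V W : Type*} [AddCommGroup V] [Module 𝕜 V]
    [AddCommGroup W] [Module 𝕜 W] (f : V →ₗ[𝕜] W) (φ : V →ₗ[𝕜] 𝕜)
    (h : LinearMap.ker f ≤ LinearMap.ker φ) : ∃ ψ : W →ₗ[𝕜] 𝕜, ψ ∘ₗ f = φ := by
  have : φ ∈ LinearMap.range f.dualMap := by
    rw [LinearMap.range_dualMap_eq_dualAnnihilator_ker, Submodule.mem_dualAnnihilator]
    exact fun w hw => h hw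
  exact this

/-- Given two chains of subspaces of a nonzero finite-dimensional space, there are a vector `e`
and a functional `φ` with `φ e = 1` such that each member of the chains contains `e` or is killed
by `φ`. -/
theorem exists_vector_functional_of_chains {V : Type*} [AddCommGroup V] [Module 𝕜 V]
    [FiniteDimensional 𝕜 V] [Nontrivial V] (A B : Set (Submodule 𝕜 V))
    (hA : IsChain (· ≤ ·) A) (hB : IsChain (· ≤ ·) B) :
    ∃ (e : V) (φ : V →ₗ[𝕜] 𝕜), φ e = 1 ∧ (∀ K ∈ A, e ∈ K ∨ K ≤ LinearMap.ker φ) ∧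
      ∀ K ∈ B, e ∈ K ∨ K ≤ LinearMap.ker φ := by
  have hne : {K | K ∈ insert ⊤ A ∧ K ≠ ⊥}.Nonempty := ⟨⊤, Or.inl rfl, top_ne_bot⟩
  obtain ⟨K₀, ⟨hK₀, hK₀'⟩, hmin⟩ :=
    (wellFounded_lt (α := Submodule 𝕜 V)).has_min _ hne
  obtain ⟨e, heK, he⟩ := Submodule.exists_mem_ne_zero_of_ne_bot hK₀'
  have heU : e ∉ sSup {K | K ∈ B ∧ e ∉ K} := by
    rcases Set.eq_empty_or_nonempty {K | K ∈ B ∧ e ∉ K} with h | h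
    · simpa [h] using he
    · rw [Submodule.mem_sSup_of_directed h
        (hB.mono fun _ h => h.1).directedOn]
      rintro ⟨K, hK, hK'⟩
      exact hK.2 hK'
  obtain ⟨φ, hφ, hφU⟩ := Submodule.exists_le_ker_of_notMem heU
  refine ⟨e, (φ e)⁻¹ • φ, by simp [hφ], fun K hK => ?_, fun K hK => ?_⟩
  · by_cases hKb : K = ⊥
    · exact Or.inr (hKb ▸ bot_le)
    · refine Or.inl ?_
      have hle : K₀ ≤ K := by
        rcases hK₀ with rfl | hK₀
        · by_contra hcon
          exact hmin K ⟨Or.inr hK, hKb⟩ (lt_top_iff_ne_top.2 fun h => hcon h.ge)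
        · rcases hA.total hK₀ hK with h | h
          · exact h
          · by_contra hcon
            exact hmin K ⟨Or.inr hK, hKb⟩ (lt_of_le_not_ge h hcon)
      exact hle heK
  · by_cases heK : e ∈ K
    · exact Or.inl heK
    · refine Or.inr fun v hv => ?_
      have : φ v = 0 := hφU (le_sSup (show K ∈ {K | K ∈ B ∧ e ∉ K} from ⟨hK, heK⟩) hv)
      simp [this]

/-- In a directed system with least index `i₀`, a functional at `i₀` that extends along each map
extends to a compatible family of functionals. -/
theorem exists_compatible_functionals {ι : Type*} [Preorder ι] [IsDirectedOrder ι]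
    {G : ι → Type*} [∀ i, AddCommGroup (G i)] [∀ i, Module 𝕜 (G i)]
    (f : ∀ i j, i ≤ j → G i →ₗ[𝕜] G j) [DirectedSystem G (fun i j h => f i j h)]
    (i₀ : ι) (φ : G i₀ →ₗ[𝕜] 𝕜)
    (hφ : ∀ i (h : i₀ ≤ i), LinearMap.ker (f i₀ i h) ≤ LinearMap.ker φ) :
    ∃ Φ : ∀ i, G i →ₗ[𝕜] 𝕜, Φ i₀ = φ ∧ ∀ i j (h : i ≤ j), Φ j ∘ₗ f i j h = Φ i := by
  classical
  obtain ⟨ψ, hψ⟩ := LinearMap.exists_comp_eq_of_ker_le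
    (Module.DirectLimit.of 𝕜 ι G f i₀) φ (by
      intro v hv
      obtain ⟨j, hj, hj'⟩ := Module.DirectLimit.of.zero_exact (LinearMap.mem_ker.1 hv)
      exact hφ j hj hj')
  refine ⟨fun i => ψ ∘ₗ Module.DirectLimit.of 𝕜 ι G f i, hψ, fun i j h => ?_⟩
  ext v
  simp

/-- In an inverse system of finite-dimensional spaces with greatest index `i₀`, an element at
`i₀` that lifts along each map lifts to a compatible family of elements. -/
theorem exists_compatible_lifts {ι : Type*} [Preorder ι] [IsCodirectedOrder ι]
    {G : ι → Type*} [∀ i, AddCommGroup (G i)] [∀ i, Module 𝕜 (G i)]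
    [∀ i, FiniteDimensional 𝕜 (G i)]
    (f : ∀ i j, i ≤ j → G i →ₗ[𝕜] G j) [DirectedSystem G (fun i j h => f i j h)]
    (i₀ : ι) (e : G i₀) (he : ∀ i (h : i ≤ i₀), e ∈ LinearMap.range (f i i₀ h)) :
    ∃ E : ∀ i, G i, E i₀ = e ∧ ∀ i j (h : i ≤ j), f i j h (E i) = E j := by
  let G' : ιᵒᵈ → Type _ := fun i => Module.Dual 𝕜 (G (OrderDual.ofDual i))
  let f' : ∀ i j : ιᵒᵈ, i ≤ j → G' i →ₗ[𝕜] G' j :=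
    fun i j h => (f (OrderDual.ofDual j) (OrderDual.ofDual i) h).dualMap
  have : DirectedSystem G' (fun i j h => f' i j h) :=
    { map_self := fun i x => by
        ext v
        exact congrArg x (DirectedSystem.map_self' f v)
      map_map := fun k j i hij hjk x => by
        ext v
        exact congrArg x (DirectedSystem.map_map' f hjk hij v) }
  obtain ⟨Φ, hΦ₀, hΦ⟩ := exists_compatible_functionals (G := G') f' (OrderDual.toDual i₀)
    (Module.Dual.eval 𝕜 (G i₀) e) (by
      intro i h ψ hψ
      obtain ⟨m, hm⟩ := he (OrderDual.ofDual i) h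
      have : ψ (f (OrderDual.ofDual i) i₀ h m) = 0 := LinearMap.congr_fun hψ m
      rw [hm] at this
      exact this)
  have key : ∀ i, ∃ v : G i, ∀ ψ : Module.Dual 𝕜 (G i), ψ v = Φ (OrderDual.toDual i) ψ := by
    intro i
    obtain ⟨v, hv⟩ := (Module.evalEquiv 𝕜 (G i)).surjective (Φ (OrderDual.toDual i))
    exact ⟨v, fun ψ => LinearMap.congr_fun hv ψ⟩
  choose E hE using key
  refine ⟨E, ?_, fun i j h => ?_⟩
  · refine (Module.evalEquiv 𝕜 _).injective (LinearMap.ext fun ψ => ?_)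
    change ψ _ = ψ _
    rw [hE, hΦ₀]
    rfl
  · refine (Module.evalEquiv 𝕜 _).injective (LinearMap.ext fun ψ => ?_)
    change ψ _ = ψ _
    rw [hE, ← hΦ (OrderDual.toDual j) (OrderDual.toDual i) h]
    exact hE i (ψ ∘ₗ f i j h)

end LinearAlgebra

/-! ### Interval summands -/

namespace PersistenceModule

variable {𝕜 : Type u} [Field 𝕜] {P : Type w} [PartialOrder P]

/-- The value of a persistence module at a point. (Spelling it this way over a general poset avoids
the product category structure when `P` is a product.) -/
abbrev stalk (M : PersistenceModule 𝕜 P) (x : P) : ModuleCat.{u} 𝕜 :=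
  M.obj x

/-- The pullback of a persistence module along a monotone map. -/
def comap {Q : Type w} [PartialOrder Q] {f : Q → P} (hf : Monotone f)
    (M : PersistenceModule 𝕜 P) : PersistenceModule 𝕜 Q :=
  hf.functor ⋙ M

/-- The structure map of a persistence module, as a linear map. -/
def tr (M : PersistenceModule 𝕜 P) {x y : P} (h : x ≤ y) : M.obj x →ₗ[𝕜] M.obj y :=
  (M.map (homOfLE h)).hom

@[simp]
theorem tr_refl (M : PersistenceModule 𝕜 P) {x : P} (h : x ≤ x) (v : M.obj x) :
    M.tr h v = v := by
  simp [tr]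

@[simp]
theorem tr_tr (M : PersistenceModule 𝕜 P) {x y z : P} (h : x ≤ y) (h' : y ≤ z) (v : M.obj x) :
    M.tr h' (M.tr h v) = M.tr (h.trans h') v := by
  have : M.map (homOfLE (h.trans h')) = M.map (homOfLE h) ≫ M.map (homOfLE h') :=
    M.map_comp (homOfLE h) (homOfLE h')
  simp [tr, this]

theorem naturality_tr {M N : PersistenceModule 𝕜 P} (η : M ⟶ N) {x y : P} (h : x ≤ y)
    (v : M.obj x) : (η.app y).hom (M.tr h v) = N.tr h ((η.app x).hom v) :=
  congrArg (fun g => g.hom v) (η.naturality (homOfLE h))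

/-- The interval module over `I` is a direct summand of `M`: `e` is the image of the generator
and `φ` the retraction. -/
def HasIntervalSummand (M : PersistenceModule 𝕜 P) (I : Set P) : Prop :=
  ∃ (e : ∀ x, M.obj x) (φ : ∀ x, M.obj x →ₗ[𝕜] 𝕜),
    (∀ x ∉ I, e x = 0) ∧ (∀ x ∉ I, φ x = 0) ∧ (∀ x ∈ I, φ x (e x) = 1) ∧
    (∀ x y (h : x ≤ y), x ∈ I → M.tr h (e x) = e y) ∧
    ∀ x y (h : x ≤ y), y ∈ I → φ y ∘ₗ M.tr h = φ x

theorem exists_compatible_functionals_on (M : PersistenceModule 𝕜 P) (D : Set P)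
    (hD : DirectedOn (· ≤ ·) D) {x : P} (hx : x ∈ D) (φ : M.obj x →ₗ[𝕜] 𝕜)
    (hφ : ∀ y ∈ D, ∀ h : x ≤ y, LinearMap.ker (M.tr h) ≤ LinearMap.ker φ) :
    ∃ Φ : ∀ y, M.obj y →ₗ[𝕜] 𝕜, Φ x = φ ∧ (∀ y ∉ D, Φ y = 0) ∧
      ∀ y ∈ D, ∀ z ∈ D, ∀ h : y ≤ z, Φ z ∘ₗ M.tr h = Φ y := by
  classical
  have : IsDirectedOrder D := ⟨hD.directed_val⟩
  have : DirectedSystem (fun i : D => M.obj i.1) (fun i j h => M.tr (Subtype.coe_le_coe.2 h)) :=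
    { map_self := fun i v => M.tr_refl _ v
      map_map := fun k j i hij hjk v => M.tr_tr _ _ v }
  obtain ⟨Φ, h₀, h⟩ := exists_compatible_functionals (G := fun i : D => M.obj i.1)
    (fun i j h => M.tr (Subtype.coe_le_coe.2 h)) ⟨x, hx⟩ φ (fun i h => hφ i.1 i.2 h)
  refine ⟨fun y => if hy : y ∈ D then Φ ⟨y, hy⟩ else 0, ?_, ?_, ?_⟩
  · simpa [hx] using h₀
  · intro y hy
    simp [hy]
  · intro y hy z hz hyz
    simpa [hy, hz] using h ⟨y, hy⟩ ⟨z, hz⟩ hyz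

theorem exists_compatible_lifts_on (M : PersistenceModule 𝕜 P) (hM : M.IsPFD) (D : Set P)
    (hD : DirectedOn (· ≥ ·) D) {x : P} (hx : x ∈ D) (e : M.obj x)
    (he : ∀ y ∈ D, ∀ h : y ≤ x, e ∈ LinearMap.range (M.tr h)) :
    ∃ E : ∀ y, M.obj y, E x = e ∧ (∀ y ∉ D, E y = 0) ∧
      ∀ y ∈ D, ∀ z ∈ D, ∀ h : y ≤ z, M.tr h (E y) = E z := by
  classical
  have : IsCodirectedOrder D := ⟨hD.directed_val⟩
  have : DirectedSystem (fun i : D => M.obj i.1) (fun i j h => M.tr (Subtype.coe_le_coe.2 h)) :=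
    { map_self := fun i v => M.tr_refl _ v
      map_map := fun k j i hij hjk v => M.tr_tr _ _ v }
  have : ∀ i : D, FiniteDimensional 𝕜 (M.obj i.1) := fun i => hM i.1
  obtain ⟨E, h₀, h⟩ := exists_compatible_lifts (G := fun i : D => M.obj i.1)
    (fun i j h => M.tr (Subtype.coe_le_coe.2 h)) ⟨x, hx⟩ e (fun i h => he i.1 i.2 h)
  refine ⟨fun y => if hy : y ∈ D then E ⟨y, hy⟩ else 0, ?_, ?_, ?_⟩
  · simpa [hx] using h₀
  · intro y hy
    simp [hy]
  · intro y hy z hz hyz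
    simpa [hy, hz] using h ⟨y, hy⟩ ⟨z, hz⟩ hyz

theorem ker_tr_mono (M : PersistenceModule 𝕜 P) {x y z : P} (h : x ≤ y) (h' : x ≤ z)
    (hyz : y ≤ z) : LinearMap.ker (M.tr h) ≤ LinearMap.ker (M.tr h') := by
  intro v hv
  have := congrArg (M.tr hyz) (LinearMap.mem_ker.1 hv)
  simpa using this

theorem range_tr_mono (M : PersistenceModule 𝕜 P) {x y z : P} (h : x ≤ z) (h' : y ≤ z)
    (hxy : x ≤ y) : LinearMap.range (M.tr h) ≤ LinearMap.range (M.tr h') := by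
  rintro _ ⟨v, rfl⟩
  exact ⟨M.tr hxy v, by simp⟩

/-- A nonzero pointwise finite-dimensional module over a linear order has an interval summand. -/
theorem exists_intervalSummand_of_linearOrder {α : Type w} [LinearOrder α]
    (M : PersistenceModule 𝕜 α) (hM : M.IsPFD) (x : α) [Nontrivial (M.obj x)] :
    ∃ J : Set α, IsPosetInterval J ∧ M.HasIntervalSummand J := by
  classical
  have := hM x
  obtain ⟨e, φ, hφe, hker, hrange⟩ := exists_vector_functional_of_chains
    (Set.range fun b : Set.Ici x => LinearMap.ker (M.tr b.2))
    (Set.range fun a : Set.Iic x => LinearMap.range (M.tr a.2))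
    (by
      rintro _ ⟨a, rfl⟩ _ ⟨b, rfl⟩ -
      exact (le_total a.1 b.1).imp (M.ker_tr_mono _ _) (M.ker_tr_mono _ _))
    (by
      rintro _ ⟨a, rfl⟩ _ ⟨b, rfl⟩ -
      exact (le_total a.1 b.1).imp (M.range_tr_mono _ _) (M.range_tr_mono _ _))
  have he : e ≠ 0 := by
    rintro rfl
    simp at hφe
  let L : Set α := {a | ∃ h : a ≤ x, e ∈ LinearMap.range (M.tr h)}
  let U : Set α := {b | ∃ h : x ≤ b, M.tr h e ≠ 0}
  have hxL : x ∈ L := ⟨le_rfl, e, by simp⟩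
  have hxU : x ∈ U := ⟨le_rfl, by simpa using he⟩
  have hLup : ∀ a ∈ L, ∀ b, a ≤ b → b ≤ x → b ∈ L := by
    rintro a ⟨h, ha⟩ b hab hbx
    exact ⟨hbx, M.range_tr_mono h hbx hab ha⟩
  have hUdown : ∀ a ∈ U, ∀ b, b ≤ a → x ≤ b → b ∈ U := by
    rintro a ⟨h, ha⟩ b hab hbx
    exact ⟨hbx, fun hb => ha (M.ker_tr_mono hbx h hab hb)⟩
  obtain ⟨Φ, hΦx, -, hΦ⟩ := M.exists_compatible_functionals_on U
    (fun a ha b hb => ⟨max a b, by rcases max_choice a b with h | h <;> rwa [h],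
      le_max_left _ _, le_max_right _ _⟩) hxU φ (by
      rintro b ⟨_, hb⟩ h
      exact (hker _ ⟨⟨b, h⟩, rfl⟩).resolve_left hb)
  obtain ⟨E, hEx, -, hE⟩ := M.exists_compatible_lifts_on hM L
    (fun a ha b hb => ⟨min a b, by rcases min_choice a b with h | h <;> rwa [h],
      min_le_left _ _, min_le_right _ _⟩) hxL e (by
      rintro b ⟨_, hb⟩ h
      exact hb)
  let J : Set α := {a | min a x ∈ L ∧ max a x ∈ U}
  have hxJ : x ∈ J := by simpa [J] using ⟨hxL, hxU⟩
  refine ⟨J, ⟨⟨x, hxJ⟩, ?_, ?_⟩, fun a => if a ∈ J then M.tr (min_le_left a x) (E (min a x)) else 0,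
    fun a => if a ∈ J then Φ (max a x) ∘ₗ M.tr (le_max_left a x) else 0,
    fun a ha => if_neg ha, fun a ha => if_neg ha, ?_, ?_, ?_⟩
  · rintro a b c ⟨ha, -⟩ ⟨-, hb⟩ hac hcb
    exact ⟨hLup _ ha _ (min_le_min_right _ hac) (min_le_right _ _),
      hUdown _ hb _ (max_le_max_right _ hcb) (le_max_right _ _)⟩
  · intro a b ha hb
    exact .single ⟨ha, hb, le_total a b⟩
  · intro a ha
    have h1 := hE _ ha.1 x hxL (min_le_right _ _)
    have h2 := LinearMap.congr_fun (hΦ x hxU _ ha.2 (le_max_right _ _)) e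
    rw [hΦx, hφe, ← hEx, ← h1] at h2
    simpa [ha] using h2
  · intro a b h ha
    have hbL : min b x ∈ L := hLup _ ha.1 _ (min_le_min_right _ h) (min_le_right _ _)
    have h1 := hE _ ha.1 _ hbL (min_le_min_right _ h)
    have h2 : M.tr h (M.tr (min_le_left a x) (E (min a x))) =
        M.tr (min_le_left b x) (E (min b x)) := by
      rw [← h1]
      simp
    beta_reduce
    rw [if_pos ha, h2]
    split_ifs with hb
    · rfl
    · have hxb : x ≤ b := by
        by_contra hcon
        refine hb ⟨hbL, ?_⟩
        rwa [max_eq_right (not_le.1 hcon).le]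
      have hbU : ¬ M.tr hxb e ≠ 0 := fun hne => hb ⟨hbL, by
        rw [max_eq_left hxb]
        exact ⟨hxb, hne⟩⟩
      rw [← hE _ hbL x hxL (min_le_right _ _)] at hEx
      rw [← hEx] at hbU
      simpa using hbU
  · intro a b h hb
    have haU : max a x ∈ U := hUdown _ hb.2 _ (max_le_max_right _ h) (le_max_right _ _)
    have h1 := hΦ _ haU _ hb.2 (max_le_max_right _ h)
    have h2 : (Φ (max b x) ∘ₗ M.tr (le_max_left b x)) ∘ₗ M.tr h =
        Φ (max a x) ∘ₗ M.tr (le_max_left a x) := by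
      rw [← h1]
      ext v
      simp
    beta_reduce
    rw [if_pos hb, h2]
    split_ifs with ha
    · rfl
    · have hax : a ≤ x := by
        by_contra hcon
        refine ha ⟨?_, haU⟩
        rwa [min_eq_right (not_le.1 hcon).le]
      have haL : e ∉ LinearMap.range (M.tr hax) := fun hmem => ha ⟨by
        rw [min_eq_left hax]
        exact ⟨hax, hmem⟩, haU⟩
      have h3 := (hrange _ ⟨⟨a, hax⟩, rfl⟩).resolve_left haL
      have h4 := hΦ x hxU _ haU (le_max_right _ _)
      ext v
      have h5 : φ (M.tr hax v) = 0 := h3 ⟨v, rfl⟩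
      rw [← hΦx, ← h4] at h5
      simpa using h5

end PersistenceModule

/-! ### Decompositions from summands -/

namespace PersistenceModule

variable {𝕜 : Type u} [Field 𝕜] {P : Type w} [PartialOrder P]

section Generator

variable {I : Set P} (hI : IsPosetInterval I)

/-- The coordinate of an element of an interval module. -/
noncomputable def intervalCoord (x : P) : (intervalModule 𝕜 I hI).obj x →ₗ[𝕜] 𝕜 :=
  (intervalStalk 𝕜 I x).subtype

variable (𝕜) in
/-- The generator of the interval module over `I` at a point of `I`. -/
noncomputable def intervalGenerator {x : P} (hx : x ∈ I) : (intervalModule 𝕜 I hI).obj x :=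
  (⟨1, by simp [intervalStalk, hx]⟩ : intervalStalk 𝕜 I x)

@[simp]
theorem intervalCoord_generator {x : P} (hx : x ∈ I) :
    intervalCoord hI x (intervalGenerator 𝕜 hI hx) = 1 :=
  rfl

theorem intervalModule_tr_generator {x y : P} (h : x ≤ y) (hx : x ∈ I) (hy : y ∈ I) :
    (intervalModule 𝕜 I hI).tr h (intervalGenerator 𝕜 hI hx) = intervalGenerator 𝕜 hI hy := by
  change intervalMap 𝕜 I x y (⟨1, _⟩ : intervalStalk 𝕜 I x) = (⟨1, _⟩ : intervalStalk 𝕜 I y)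
  rw [intervalMap, dif_pos ⟨hx, hy⟩]
  rfl

theorem eq_coord_smul_generator {x : P} (hx : x ∈ I) (c : (intervalModule 𝕜 I hI).obj x) :
    c = intervalCoord hI x c • intervalGenerator 𝕜 hI hx :=
  Subtype.ext (mul_one _).symm

theorem intervalModule_eq_zero {x : P} (hx : x ∉ I) (c : (intervalModule 𝕜 I hI).obj x) :
    c = 0 := by
  have h : intervalStalk 𝕜 I x = ⊥ := by simp [intervalStalk, hx]
  exact Subtype.ext ((Submodule.mem_bot 𝕜).1 (h ▸ Subtype.property c))

end Generator

/-- The morphism from an interval module given by the image of its generator. -/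
noncomputable def ofSection (F : PersistenceModule 𝕜 P) {I : Set P} (hI : IsPosetInterval I)
    (e : ∀ x, F.obj x) (he₀ : ∀ x ∉ I, e x = 0)
    (he : ∀ x y (h : x ≤ y), x ∈ I → F.tr h (e x) = e y) : intervalModule 𝕜 I hI ⟶ F where
  app x := ModuleCat.ofHom (LinearMap.toSpanSingleton 𝕜 (F.obj x) (e x) ∘ₗ intervalCoord hI x)
  naturality x y f := by
    ext c
    change intervalCoord hI y ((intervalModule 𝕜 I hI).tr (leOfHom f) c) • e y =
      F.tr (leOfHom f) (intervalCoord hI x c • e x)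
    by_cases hx : x ∈ I
    · rw [map_smul, he x y _ hx]
      by_cases hy : y ∈ I
      · conv_lhs => rw [eq_coord_smul_generator hI hx c, map_smul,
          intervalModule_tr_generator hI _ hx hy, map_smul, intervalCoord_generator]
        simp
      · simp [he₀ y hy]
    · rw [intervalModule_eq_zero hI hx c]
      simp

/-- Sections whose nonzero values form a basis at each point decompose the module. -/
theorem isIntervalDecomposableOver_of_sections (F : PersistenceModule 𝕜 P) (B : Set P → Prop)
    (hB : ∀ I, B I → IsPosetInterval I) {ι : Type w} (e : ι → ∀ x, F.obj x)
    (hblock : ∀ i, B {x | e i x ≠ 0})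
    (hnat : ∀ i x y (h : x ≤ y), e i x ≠ 0 → F.tr h (e i x) = e i y)
    (hindep : ∀ x, LinearIndependent 𝕜 (fun i : {i // e i x ≠ 0} => e i x))
    (hspan : ∀ x, ⊤ ≤ Submodule.span 𝕜 (Set.range fun i : {i // e i x ≠ 0} => e i x)) :
    F.IsIntervalDecomposableOver B := by
  have hI : ∀ i, IsPosetInterval {x | e i x ≠ 0} := fun i => hB _ (hblock i)
  let b : ∀ x, Module.Basis {i // e i x ≠ 0} 𝕜 (F.obj x) := fun x => .mk (hindep x) (hspan x)
  have hb : ∀ x (i : {i // e i x ≠ 0}), b x i = e i x := fun x i => by simp [b]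
  let c : Cofan fun i => intervalModule 𝕜 {x | e i x ≠ 0} (hI i) :=
    Cofan.mk F fun i => F.ofSection (hI i) (e i) (fun x hx => not_not.1 hx) (hnat i)
  let d : ∀ (s : Cofan fun i => intervalModule 𝕜 {x | e i x ≠ 0} (hI i)) x,
      F.obj x →ₗ[𝕜] s.pt.obj x := fun s x =>
    (b x).constr 𝕜 fun i => ((s.inj i.1).app x).hom (intervalGenerator 𝕜 (hI i.1) i.2)
  have hd : ∀ s x i (h : e i x ≠ 0), d s x (e i x) =
      ((s.inj i).app x).hom (intervalGenerator 𝕜 (hI i) h) := by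
    intro s x i h
    rw [← hb x ⟨i, h⟩]
    exact (b x).constr_basis 𝕜 _ _
  refine ⟨ι, fun i => {x | e i x ≠ 0}, hI, c, hblock, ⟨?_⟩, ⟨Iso.refl F⟩⟩
  refine Cofan.IsColimit.mk c
    (fun s => { app := fun x => ModuleCat.ofHom (d s x), naturality := ?_ }) ?_ ?_
  · intro x y f
    refine ModuleCat.hom_ext ((b x).ext fun i => ?_)
    rw [hb]
    change d s y (F.tr (leOfHom f) (e i.1 x)) = s.pt.tr (leOfHom f) (d s x (e i.1 x))
    rw [hd s x i.1 i.2, hnat i.1 x y _ i.2]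
    refine Eq.trans ?_ (naturality_tr (s.inj i.1) (leOfHom f) _)
    by_cases hy : e i.1 y = 0
    · rw [intervalModule_eq_zero (hI i.1) (not_not.2 hy)
        ((intervalModule 𝕜 {x | e i.1 x ≠ 0} (hI i.1)).tr _ _), hy, map_zero]
      exact (map_zero _).symm
    · rw [hd s y i.1 hy]
      exact congrArg _ (intervalModule_tr_generator (hI i.1) (leOfHom f) i.2 hy).symm
  · intro s i
    refine NatTrans.ext (funext fun x => ModuleCat.hom_ext (LinearMap.ext fun t => ?_))
    change d s x (intervalCoord (hI i) x t • e i x) = ((s.inj i).app x).hom t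
    by_cases hx : e i x = 0
    · rw [intervalModule_eq_zero (hI i) (not_not.2 hx) t, hx, smul_zero, map_zero]
      exact (map_zero _).symm
    · rw [map_smul, hd s x i hx, ← map_smul]
      exact congrArg _ (eq_coord_smul_generator (hI i) hx t).symm
  · intro s m hm
    refine NatTrans.ext (funext fun x => ModuleCat.hom_ext ((b x).ext fun i => ?_))
    rw [hb]
    change (m.app x).hom (e i.1 x) = d s x (e i.1 x)
    rw [hd s x i.1 i.2, ← hm i.1]
    change _ = (m.app x).hom ((1 : 𝕜) • e i.1 x)
    rw [one_smul]

/-- The span of the values at `x` of a set of sections. -/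
def valueSpan (F : PersistenceModule 𝕜 P) (S : Set (∀ x, F.obj x)) (x : P) :
    Submodule 𝕜 (F.obj x) :=
  Submodule.span 𝕜 ((fun e : ∀ x, F.obj x => e x) '' S)

/-- A splitting of `F` into interval modules over intervals satisfying `B`, given by the
sections in `S`, and a complement `C`. -/
structure PartialDecomposition (F : PersistenceModule 𝕜 P) (B : Set P → Prop) where
  /-- The generators of the interval summands. -/
  S : Set (∀ x, F.obj x)
  /-- The complement. -/
  C : ∀ x, Submodule 𝕜 (F.obj x)
  block : ∀ e ∈ S, B {x | e x ≠ 0}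
  tr_eq : ∀ e ∈ S, ∀ x y (h : x ≤ y), e x ≠ 0 → F.tr h (e x) = e y
  stable : ∀ x y (h : x ≤ y), ∀ v ∈ C x, F.tr h v ∈ C y
  indep : ∀ x, LinearIndepOn 𝕜 (fun e : ∀ x, F.obj x => e x) {e | e ∈ S ∧ e x ≠ 0}
  isCompl : ∀ x, IsCompl (C x) (F.valueSpan S x)

namespace PartialDecomposition

variable {F : PersistenceModule 𝕜 P} {B : Set P → Prop}

instance : Preorder (PartialDecomposition F B) where
  le D D' := D.S ⊆ D'.S ∧ ∀ x, D'.C x ≤ D.C x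
  le_refl D := ⟨subset_rfl, fun _ => le_rfl⟩
  le_trans _ _ _ h h' := ⟨h.1.trans h'.1, fun x => (h'.2 x).trans (h.2 x)⟩

/-- The trivial decomposition, with no interval summands. -/
def trivial (F : PersistenceModule 𝕜 P) (B : Set P → Prop) : PartialDecomposition F B where
  S := ∅
  C _ := ⊤
  block := by simp
  tr_eq := by simp
  stable := by simp
  indep x := by simp
  isCompl x := by simpa [valueSpan] using isCompl_top_bot

theorem bddAbove_of_isChain (hF : F.IsPFD) (c : Set (PartialDecomposition F B))
    (hc : IsChain (· ≤ ·) c) (hne : c.Nonempty) : BddAbove c := by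
  have hdir : Directed (· ≤ ·) fun D : c => D.1.S := by
    intro D D'
    rcases hc.total D.2 D'.2 with h | h
    · exact ⟨D', h.1, subset_rfl⟩
    · exact ⟨D, subset_rfl, h.1⟩
  have hmin : ∀ x, ∃ D ∈ c, ∀ D' ∈ c, D.C x ≤ D'.C x := by
    intro x
    have := hF x
    obtain ⟨_, ⟨D, hD, rfl⟩, hm⟩ := (wellFounded_lt (α := Submodule 𝕜 (F.obj x))).has_min
      ((fun D => D.C x) '' c) (hne.image _)
    refine ⟨D, hD, fun D' hD' => ?_⟩
    rcases hc.total hD hD' with h | h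
    · by_contra hcon
      exact hm _ ⟨D', hD', rfl⟩ (lt_of_le_not_ge (h.2 x) hcon)
    · exact h.2 x
  have hcne : Nonempty c := hne.to_subtype
  let U : PartialDecomposition F B :=
    { S := ⋃ D : c, D.1.S
      C := fun x => ⨅ D : c, D.1.C x
      block := by
        intro e he
        obtain ⟨D, hD⟩ := Set.mem_iUnion.1 he
        exact D.1.block e hD
      tr_eq := by
        intro e he
        obtain ⟨D, hD⟩ := Set.mem_iUnion.1 he
        exact D.1.tr_eq e hD
      stable := by
        intro x y h v hv
        rw [Submodule.mem_iInf] at hv ⊢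
        exact fun D => D.1.stable x y h v (hv D)
      indep := by
        intro x
        have : {e | e ∈ ⋃ D : c, D.1.S ∧ e x ≠ 0} = ⋃ D : c, {e | e ∈ D.1.S ∧ e x ≠ 0} := by
          ext e
          simp only [Set.mem_ofPred_eq, Set.mem_iUnion, exists_and_right]
        rw [this]
        refine linearIndepOn_iUnion_of_directed ?_ fun D => D.1.indep x
        intro D D'
        obtain ⟨D'', h, h'⟩ := hdir D D'
        exact ⟨D'', fun e he => ⟨h he.1, he.2⟩, fun e he => ⟨h' he.1, he.2⟩⟩
      isCompl := by
        intro x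
        rw [valueSpan, Set.image_iUnion, Submodule.span_iUnion]
        constructor
        · rw [Submodule.disjoint_def]
          intro v hv hv'
          have hdir' : Directed (· ≤ ·) fun D : c => Submodule.span 𝕜
              ((fun e : ∀ x, F.obj x => e x) '' D.1.S) := by
            intro D D'
            obtain ⟨D'', h, h'⟩ := hdir D D'
            exact ⟨D'', Submodule.span_mono (Set.image_mono h),
              Submodule.span_mono (Set.image_mono h')⟩
          rw [Submodule.mem_iSup_of_directed _ hdir'] at hv'
          obtain ⟨D, hD⟩ := hv'
          exact Submodule.disjoint_def.1 (D.1.isCompl x).disjoint v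
            ((Submodule.mem_iInf _).1 hv D) hD
        · obtain ⟨D, hD, hD'⟩ := hmin x
          refine (D.isCompl x).codisjoint.mono (le_iInf fun D' => hD' D'.1 D'.2) ?_
          exact le_iSup (fun D : c =>
            Submodule.span 𝕜 ((fun e : ∀ x, F.obj x => e x) '' D.1.S)) ⟨D, hD⟩ }
  exact ⟨U, fun D hD => ⟨Set.subset_iUnion (fun D : c => D.1.S) ⟨D, hD⟩,
    fun x => iInf_le (fun D : c => D.1.C x) ⟨D, hD⟩⟩⟩

/-- The complement as a persistence module. -/
def complement (D : PartialDecomposition F B) : PersistenceModule 𝕜 P where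
  obj x := ModuleCat.of 𝕜 (D.C x)
  map {x y} f := ModuleCat.ofHom ((F.tr (leOfHom f)).restrict (D.stable x y (leOfHom f)))
  map_id x := by
    refine ModuleCat.hom_ext (LinearMap.ext fun v => ?_)
    exact Subtype.ext (F.tr_refl (le_refl x) (Subtype.val v))
  map_comp {x y z} f g := by
    refine ModuleCat.hom_ext (LinearMap.ext fun v => ?_)
    exact Subtype.ext (F.tr_tr (leOfHom f) (leOfHom g) (Subtype.val v)).symm

/-- The inclusion of the complement. -/
def complementι (D : PartialDecomposition F B) : D.complement ⟶ F where
  app x := ModuleCat.ofHom (D.C x).subtype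

theorem tr_mem_valueSpan (D : PartialDecomposition F B) {x y : P} (h : x ≤ y) {v : F.obj x}
    (hv : v ∈ F.valueSpan D.S x) : F.tr h v ∈ F.valueSpan D.S y := by
  suffices F.valueSpan D.S x ≤ (F.valueSpan D.S y).comap (F.tr h) from this hv
  rw [valueSpan, Submodule.span_le]
  rintro _ ⟨e, he, rfl⟩
  change F.tr h (e x) ∈ F.valueSpan D.S y
  by_cases hx : e x = 0
  · simp [hx]
  · rw [D.tr_eq e he x y h hx]
    exact Submodule.subset_span ⟨e, he, rfl⟩

/-- The projection to the complement. -/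
noncomputable def complementπ (D : PartialDecomposition F B) : F ⟶ D.complement where
  app x := ModuleCat.ofHom (Submodule.projectionOnto _ _ (D.isCompl x))
  naturality x y f := by
    ext v
    change Submodule.projectionOnto _ _ (D.isCompl y) (F.tr (leOfHom f) v) =
      D.complement.tr (leOfHom f) (Submodule.projectionOnto _ _ (D.isCompl x) v)
    obtain ⟨c, hc, s, hs, rfl⟩ := Submodule.mem_sup.1
      ((D.isCompl x).sup_eq_top ▸ Submodule.mem_top : v ∈ _)
    rw [map_add, map_add, map_add,
      (Submodule.projectionOnto_apply_eq_zero_iff (D.isCompl y)).2 (D.tr_mem_valueSpan _ hs),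
      (Submodule.projectionOnto_apply_eq_zero_iff (D.isCompl x)).2 hs,
      Submodule.projectionOnto_apply_of_mem_left (D.isCompl x) hc,
      Submodule.projectionOnto_apply_of_mem_left (D.isCompl y) (D.stable _ _ _ _ hc),
      add_zero, add_zero]
    rfl

theorem complementι_π (D : PartialDecomposition F B) :
    D.complementι ≫ D.complementπ = 𝟙 D.complement := by
  ext x v
  exact Submodule.projectionOnto_apply_left (D.isCompl x) v

/-- Splitting an interval summand off the complement. -/
theorem exists_gt_of_hasIntervalSummand (D : PartialDecomposition F B) {I : Set P}
    (hne : I.Nonempty) (hI : B I) (h : D.complement.HasIntervalSummand I) : ∃ D', D < D' := by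
  obtain ⟨e, φ, he₀, hφ₀, hφe, he, hφ⟩ := h
  let e : ∀ x, D.C x := e
  let φ : ∀ x, D.C x →ₗ[𝕜] 𝕜 := φ
  have hsupp : ∀ x, (e x : F.obj x) ≠ 0 ↔ x ∈ I := by
    intro x
    refine ⟨fun hx => by_contra fun hxI => hx ?_, fun hx h0 => ?_⟩
    · exact congrArg Subtype.val (he₀ x hxI)
    · have h1 : φ x (e x) = 1 := hφe x hx
      rw [Subtype.ext h0 (a2 := (0 : D.C x)), map_zero] at h1
      exact zero_ne_one h1
  let D' : PartialDecomposition F B :=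
    { S := insert (fun x => (e x : F.obj x)) D.S
      C := fun x => (LinearMap.ker (φ x)).map (D.C x).subtype
      block := by
        rintro _ (rfl | he')
        · simpa only [hsupp, Set.ofPred_mem_eq] using hI
        · exact D.block _ he'
      tr_eq := by
        rintro _ (rfl | he')
        · intro x y h hx
          exact congrArg Subtype.val (he x y h ((hsupp x).1 hx))
        · exact D.tr_eq _ he'
      stable := by
        rintro x y h _ ⟨v, hv, rfl⟩
        refine ⟨⟨F.tr h v, D.stable x y h v v.2⟩, ?_, rfl⟩
        by_cases hy : y ∈ I
        · have h1 : φ y ⟨F.tr h v, D.stable x y h v v.2⟩ = φ x v :=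
            LinearMap.congr_fun (hφ x y h hy) v
          exact h1.trans hv
        · have h1 : φ y = 0 := hφ₀ y hy
          simp [h1]
      indep := by
        intro x
        by_cases hx : x ∈ I
        · have hset : {e' | e' ∈ insert (fun x => (e x : F.obj x)) D.S ∧ e' x ≠ 0} =
              insert (fun x => (e x : F.obj x)) {e' | e' ∈ D.S ∧ e' x ≠ 0} := by
            ext e'
            have := (hsupp x).2 hx
            simp only [Set.mem_ofPred_eq, Set.mem_insert_iff]
            constructor
            · tauto
            · rintro (rfl | h)
              · exact ⟨Or.inl rfl, this⟩
              · exact ⟨Or.inr h.1, h.2⟩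
          rw [hset]
          refine (D.indep x).insert fun hmem => (hsupp x).2 hx ?_
          refine Submodule.disjoint_def.1 (D.isCompl x).disjoint _ (e x).2 ?_
          exact Submodule.span_mono (Set.image_mono fun _ h => h.1) hmem
        · refine (D.indep x).mono ?_
          rintro e' ⟨rfl | h, h'⟩
          · exact absurd ((hsupp x).1 h') hx
          · exact ⟨h, h'⟩
      isCompl := by
        intro x
        rw [valueSpan, Set.image_insert_eq, Submodule.span_insert]
        have hd := Submodule.disjoint_def.1 (D.isCompl x).disjoint
        constructor
        · rw [Submodule.disjoint_def]
          rintro _ ⟨v, hv, rfl⟩ hv'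
          obtain ⟨_, hc, s, hs, hvs⟩ := Submodule.mem_sup.1 hv'
          obtain ⟨c, rfl⟩ := Submodule.mem_span_singleton.1 hc
          have hs0 : s = 0 := hd s (by
            rw [← eq_sub_iff_add_eq'] at hvs
            rw [hvs]
            exact sub_mem v.2 ((D.C x).smul_mem c (e x).2)) hs
          have hvc : v = c • e x := Subtype.ext (by simpa [hs0] using hvs.symm)
          by_cases hx : x ∈ I
          · have h1 : φ x (e x) = 1 := hφe x hx
            have h2 : φ x v = 0 := hv
            rw [hvc, map_smul, h1, smul_eq_mul, mul_one] at h2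
            simp [hvc, h2]
          · have h1 : e x = 0 := he₀ x hx
            simp [hvc, h1]
        · rw [codisjoint_iff, eq_top_iff]
          intro v _
          obtain ⟨c, hc, s, hs, rfl⟩ := Submodule.mem_sup.1
            ((D.isCompl x).sup_eq_top ▸ Submodule.mem_top : v ∈ _)
          have hsplit : c + s = (c - φ x ⟨c, hc⟩ • (e x : F.obj x)) +
              (φ x ⟨c, hc⟩ • (e x : F.obj x) + s) := by abel
          rw [hsplit]
          refine Submodule.add_mem_sup ⟨⟨c, hc⟩ - φ x ⟨c, hc⟩ • e x, ?_, rfl⟩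
            (Submodule.add_mem_sup (Submodule.smul_mem _ _ (Submodule.mem_span_singleton_self _))
              hs)
          by_cases hx : x ∈ I
          · have h1 : φ x (e x) = 1 := hφe x hx
            simp [h1]
          · have h1 : φ x = 0 := hφ₀ x hx
            simp [h1] }
  refine ⟨D', ⟨Set.subset_insert _ _, fun x => ?_⟩, fun hle => ?_⟩
  · exact Submodule.map_subtype_le _ _
  · obtain ⟨x, hx⟩ := hne
    obtain ⟨v, hv, hve⟩ := hle.2 x (e x).2
    have h1 : φ x (e x) = 1 := hφe x hx
    have h2 : φ x v = 0 := hv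
    rw [Subtype.ext hve, h1] at h2
    exact one_ne_zero h2

end PartialDecomposition

/-- If `Q` is stable under retracts, and each nonzero pointwise finite-dimensional module with
property `Q` has an interval summand with property `B`, then each pointwise finite-dimensional
module with property `Q` is a direct sum of such interval modules. -/
theorem isIntervalDecomposableOver_of_summands (Q : PersistenceModule 𝕜 P → Prop)
    (hretract : ∀ {M N : PersistenceModule 𝕜 P} (i : M ⟶ N) (r : N ⟶ M),
      i ≫ r = 𝟙 M → Q N → Q M)
    (B : Set P → Prop) (hB : ∀ I, B I → IsPosetInterval I)
    (hsummand : ∀ M : PersistenceModule 𝕜 P, M.IsPFD → Q M → ∀ x, Nontrivial (M.obj x) →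
      ∃ I, B I ∧ M.HasIntervalSummand I)
    (F : PersistenceModule 𝕜 P) (hF : F.IsPFD) (hQ : Q F) : F.IsIntervalDecomposableOver B := by
  have : Nonempty (PartialDecomposition F B) := ⟨.trivial F B⟩
  obtain ⟨D, hD⟩ := zorn_le_nonempty (α := PartialDecomposition F B)
    (PartialDecomposition.bddAbove_of_isChain hF)
  have hbot : ∀ x, D.C x = ⊥ := by
    intro x
    by_contra hx
    have hfd : D.complement.IsPFD := fun y => by
      have := hF y
      exact inferInstanceAs (FiniteDimensional 𝕜 (D.C y))
    obtain ⟨I, hI, hI'⟩ := hsummand D.complement hfd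
      (hretract D.complementι D.complementπ D.complementι_π hQ) x
      (Submodule.nontrivial_iff_ne_bot.2 hx)
    obtain ⟨D', hlt⟩ := D.exists_gt_of_hasIntervalSummand (hB I hI).nonempty hI hI'
    exact hD.not_lt hlt
  have hspan : ∀ x, F.valueSpan D.S x = ⊤ := fun x => by
    simpa [hbot] using (D.isCompl x).sup_eq_top
  have hfin : ∀ x, Finite {e | e ∈ D.S ∧ e x ≠ 0} := fun x => by
    have := hF x
    exact (D.indep x).finite
  have hsmall : Small.{w} D.S := by
    have hpt : ∀ e : D.S, ∃ x, e.1 x ≠ 0 := fun e => (hB _ (D.block e.1 e.2)).nonempty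
    choose p hp using hpt
    choose n hn using fun x => (hfin x).exists_equiv_fin
    let g : D.S → P × ℕ := fun e => (p e, (hn (p e)).some ⟨e.1, e.2, hp e⟩)
    have hg : ∀ x (a b : {e | e ∈ D.S ∧ e x ≠ 0}), ((hn x).some a : ℕ) = (hn x).some b → a = b :=
      fun x a b h => (hn x).some.injective (Fin.ext h)
    refine small_of_injective (β := P × ℕ) (f := g) fun e e' h => ?_
    obtain ⟨h1, h2⟩ := Prod.mk.inj h
    have h3 : ∀ x (hx : x = p e'), ((hn x).some ⟨e.1, e.2, by
        rw [hx, ← h1]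
        exact hp e⟩ : ℕ) = (hn (p e')).some ⟨e'.1, e'.2, hp e'⟩ → e = e' := by
      rintro x rfl h
      exact Subtype.ext (Subtype.mk.inj (hg _ _ _ h))
    exact h3 (p e) h1 h2
  let q := (equivShrink D.S).symm
  refine F.isIntervalDecomposableOver_of_sections B hB (ι := Shrink.{w} D.S)
    (fun i => (q i).1) (fun i => D.block _ (q i).2) (fun i => D.tr_eq _ (q i).2) ?_ ?_
  · intro x
    exact (D.indep x).linearIndependent.comp
      (fun i : {i // (q i).1 x ≠ 0} => ⟨(q i.1).1, (q i.1).2, i.2⟩)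
      (fun i j h => Subtype.ext (q.injective (Subtype.ext (Subtype.mk.inj h))))
  · intro x
    rw [← hspan x, valueSpan, Submodule.span_le]
    rintro _ ⟨e, he, rfl⟩
    by_cases hx : e x = 0
    · simp [hx]
    · refine Submodule.subset_span ⟨⟨q.symm ⟨e, he⟩, ?_⟩, ?_⟩ <;> simp [hx]

end PersistenceModule

/-! ### Squares -/

namespace PersistenceModule

section Squares

variable {𝕜 : Type u} [Field 𝕜] {P : Type w} [PartialOrder P]

/-- The square of vector spaces over `p ≤ x, y ≤ q` is a pushout, tested on functionals. -/
def IsPushoutSquare (M : PersistenceModule 𝕜 P) {p x y q : P} (hpx : p ≤ x) (hpy : p ≤ y)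
    (hxq : x ≤ q) (hyq : y ≤ q) : Prop :=
  (∀ (g₁ : M.obj x →ₗ[𝕜] 𝕜) (g₂ : M.obj y →ₗ[𝕜] 𝕜), g₁ ∘ₗ M.tr hpx = g₂ ∘ₗ M.tr hpy →
    ∃ g : M.obj q →ₗ[𝕜] 𝕜, g ∘ₗ M.tr hxq = g₁ ∧ g ∘ₗ M.tr hyq = g₂) ∧
  ∀ g g' : M.obj q →ₗ[𝕜] 𝕜, g ∘ₗ M.tr hxq = g' ∘ₗ M.tr hxq → g ∘ₗ M.tr hyq = g' ∘ₗ M.tr hyq →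
    g = g'

/-- The square of vector spaces over `p ≤ x, y ≤ q` is a pullback. -/
def IsPullbackSquare (M : PersistenceModule 𝕜 P) {p x y q : P} (hpx : p ≤ x) (hpy : p ≤ y)
    (hxq : x ≤ q) (hyq : y ≤ q) : Prop :=
  (∀ (u : M.obj x) (v : M.obj y), M.tr hxq u = M.tr hyq v →
    ∃ w : M.obj p, M.tr hpx w = u ∧ M.tr hpy w = v) ∧
  ∀ w w' : M.obj p, M.tr hpx w = M.tr hpx w' → M.tr hpy w = M.tr hpy w' → w = w'

theorem app_app_of_retract {M N : PersistenceModule 𝕜 P} {i : M ⟶ N} {r : N ⟶ M}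
    (hir : i ≫ r = 𝟙 M) (x : P) (v : M.obj x) : (r.app x).hom ((i.app x).hom v) = v := by
  have := congrArg (fun η : M ⟶ M => (η.app x).hom v) hir
  exact this

theorem IsPushoutSquare.of_retract {M N : PersistenceModule 𝕜 P} (i : M ⟶ N) (r : N ⟶ M)
    (hir : i ≫ r = 𝟙 M) {p x y q : P} {hpx : p ≤ x} {hpy : p ≤ y} {hxq : x ≤ q} {hyq : y ≤ q}
    (h : N.IsPushoutSquare hpx hpy hxq hyq) : M.IsPushoutSquare hpx hpy hxq hyq := by
  refine ⟨fun g₁ g₂ hg => ?_, fun g g' h₁ h₂ => ?_⟩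
  · obtain ⟨g, h₁, h₂⟩ := h.1 (g₁ ∘ₗ (r.app x).hom) (g₂ ∘ₗ (r.app y).hom) (by
      ext v
      have := LinearMap.congr_fun hg ((r.app p).hom v)
      simpa [naturality_tr] using this)
    refine ⟨g ∘ₗ (i.app q).hom, ?_, ?_⟩
    · ext v
      have := LinearMap.congr_fun h₁ ((i.app x).hom v)
      simpa [naturality_tr, app_app_of_retract hir] using this
    · ext v
      have := LinearMap.congr_fun h₂ ((i.app y).hom v)
      simpa [naturality_tr, app_app_of_retract hir] using this
  · have := h.2 (g ∘ₗ (r.app q).hom) (g' ∘ₗ (r.app q).hom) (by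
      ext v
      have := LinearMap.congr_fun h₁ ((r.app x).hom v)
      simpa [naturality_tr] using this) (by
      ext v
      have := LinearMap.congr_fun h₂ ((r.app y).hom v)
      simpa [naturality_tr] using this)
    ext v
    have h3 := LinearMap.congr_fun this ((i.app q).hom v)
    simpa [app_app_of_retract hir] using h3

theorem IsPullbackSquare.of_retract {M N : PersistenceModule 𝕜 P} (i : M ⟶ N) (r : N ⟶ M)
    (hir : i ≫ r = 𝟙 M) {p x y q : P} {hpx : p ≤ x} {hpy : p ≤ y} {hxq : x ≤ q} {hyq : y ≤ q}
    (h : N.IsPullbackSquare hpx hpy hxq hyq) : M.IsPullbackSquare hpx hpy hxq hyq := by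
  refine ⟨fun u v huv => ?_, fun w w' h₁ h₂ => ?_⟩
  · obtain ⟨w, h₁, h₂⟩ := h.1 ((i.app x).hom u) ((i.app y).hom v) (by
      rw [← naturality_tr, ← naturality_tr, huv])
    refine ⟨(r.app p).hom w, ?_, ?_⟩
    · rw [← naturality_tr, h₁, app_app_of_retract hir]
    · rw [← naturality_tr, h₂, app_app_of_retract hir]
  · have := h.2 ((i.app p).hom w) ((i.app p).hom w') (by
      rw [← naturality_tr, ← naturality_tr, h₁]) (by
      rw [← naturality_tr, ← naturality_tr, h₂])
    rw [← app_app_of_retract hir p w, this, app_app_of_retract hir]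

end Squares

section Lattice

variable {P : Type w} [DistribLattice P]

/-- The 2-cube spanned by two elements of a lattice. -/
def squareCube (x y : P) : Cube 2 P :=
  Monotone.functor (f := fun U : Finset (Fin 2) =>
    if 0 ∈ U then (if 1 ∈ U then x ⊔ y else x) else (if 1 ∈ U then y else x ⊓ y)) (by
    intro U V h
    have h0 : 0 ∈ U → 0 ∈ V := fun hU => h hU
    have h1 : 1 ∈ U → 1 ∈ V := fun hU => h hU
    have h2 : x ⊓ y ≤ x ⊔ y := inf_le_left.trans le_sup_left
    beta_reduce
    split_ifs <;> simp_all)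

theorem squareCube_obj (x y : P) (U : Finset (Fin 2)) : (squareCube x y).obj U =
    if 0 ∈ U then (if 1 ∈ U then x ⊔ y else x) else (if 1 ∈ U then y else x ⊓ y) :=
  rfl

theorem squareCube_le_of_ne_univ (x y : P) : ∀ U : Finset (Fin 2), U < Finset.univ →
    (squareCube x y).obj U ≤ x ∨ (squareCube x y).obj U ≤ y := by
  intro U hU
  have : ¬ (0 ∈ U ∧ 1 ∈ U) := by
    revert U
    decide
  rw [squareCube_obj]
  split_ifs <;> simp_all

theorem le_squareCube_of_ne_empty (x y : P) : ∀ U : Finset (Fin 2), ∅ < U →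
    x ≤ (squareCube x y).obj U ∨ y ≤ (squareCube x y).obj U := by
  intro U hU
  have : 0 ∈ U ∨ 1 ∈ U := by
    revert U
    decide
  rw [squareCube_obj]
  split_ifs <;> simp_all

theorem squareCube_isStronglyBicartesian (x y : P) : (squareCube x y).IsStronglyBicartesian := by
  intro S T _ hcard
  obtain ⟨rfl, rfl⟩ : S = ∅ ∧ T = Finset.univ := by
    revert S T
    decide
  refine ⟨⟨⟨fun s => homOfLE ?_, fun s j => Subsingleton.elim _ _,
    fun s m _ => Subsingleton.elim _ _⟩⟩, ⟨⟨fun s => homOfLE ?_, fun s j => Subsingleton.elim _ _,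
    fun s m _ => Subsingleton.elim _ _⟩⟩⟩
  · have h0 := leOfHom (s.π.app ⟨{0}, by decide⟩)
    have h1 := leOfHom (s.π.app ⟨{1}, by decide⟩)
    change _ ≤ (squareCube x y).obj {0} at h0
    change _ ≤ (squareCube x y).obj {1} at h1
    change _ ≤ (squareCube x y).obj ∅
    simp [squareCube_obj] at h0 h1 ⊢
    exact ⟨h0, h1⟩
  · have h0 := leOfHom (s.ι.app ⟨{0}, by decide⟩)
    have h1 := leOfHom (s.ι.app ⟨{1}, by decide⟩)
    change (squareCube x y).obj {0} ≤ _ at h0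
    change (squareCube x y).obj {1} ≤ _ at h1
    change (squareCube x y).obj Finset.univ ≤ _
    simp [squareCube_obj] at h0 h1 ⊢
    exact ⟨h0, h1⟩

variable {𝕜 : Type u} [Field 𝕜]

/-- A functor of codegree one takes the square spanned by `x` and `y` to a pushout. -/
theorem isPushoutSquare_of_isCodegree (F : PersistenceModule 𝕜 P) (hF : IsCodegree 1 F)
    {p x y q : P} (hpx : p ≤ x) (hpy : p ≤ y) (hxq : x ≤ q) (hyq : y ≤ q)
    (hp : x ⊓ y = p) (hq : x ⊔ y = q) : F.IsPushoutSquare hpx hpy hxq hyq := by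
  classical
  obtain ⟨hlim⟩ := hF _ (squareCube_isStronglyBicartesian x y)
  have htop : (squareCube x y).obj Finset.univ = q := by simp [squareCube_obj, hq]
  have hx0 : x = (squareCube x y).obj {0} := by simp [squareCube_obj]
  have hy1 : y = (squareCube x y).obj {1} := by simp [squareCube_obj]
  refine ⟨fun g₁ g₂ hg => ?_, fun g g' h₁ h₂ => ?_⟩
  · let G : ∀ z, F.obj z →ₗ[𝕜] 𝕜 := fun z =>
      if h : z ≤ x then g₁ ∘ₗ F.tr h else if h : z ≤ y then g₂ ∘ₗ F.tr h else 0
    have hG₁ : ∀ z (h : z ≤ x), G z = g₁ ∘ₗ F.tr h := fun z h => dif_pos h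
    have hG₂ : ∀ z (h : z ≤ y), G z = g₂ ∘ₗ F.tr h := by
      intro z h
      by_cases hx : z ≤ x
      · rw [hG₁ z hx]
        have hz : z ≤ p := hp ▸ le_inf hx h
        ext v
        have := LinearMap.congr_fun hg (F.tr hz v)
        simpa using this
      · simp [G, hx, h]
    have hG : ∀ z z' (h : z ≤ z'), z' ≤ x ∨ z' ≤ y → G z' ∘ₗ F.tr h = G z := by
      rintro z z' h (h' | h')
      · rw [hG₁ z' h', hG₁ z (h.trans h')]
        ext v
        simp
      · rw [hG₂ z' h', hG₂ z (h.trans h')]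
        ext v
        simp
    let s : Cocone (Cube.lowerFace (squareCube x y ⋙ F) ∅ Finset.univ) :=
      { pt := ModuleCat.of 𝕜 𝕜
        ι :=
          { app := fun U => ModuleCat.ofHom (G ((squareCube x y).obj U.1))
            naturality := fun U V f => ModuleCat.hom_ext (hG _ _
              (leOfHom ((squareCube x y).map (homOfLE (leOfHom f))))
              (squareCube_le_of_ne_univ x y V.1 V.2.2)) } }
    have hfac : ∀ (z : P) (U : Finset (Fin 2)) (hU : U < Finset.univ)
        (hz : z = (squareCube x y).obj U) (hzq : z ≤ q),
        ((hlim.desc s).hom ∘ₗ F.tr htop.ge) ∘ₗ F.tr hzq = G z := by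
      rintro _ U hU rfl hzq
      have := congrArg ModuleCat.Hom.hom (hlim.fac s ⟨U, by simp, hU⟩)
      change _ = G ((squareCube x y).obj U) at this
      rw [← this]
      ext v
      exact congrArg (hlim.desc s).hom (F.tr_tr _ _ v)
    refine ⟨(hlim.desc s).hom ∘ₗ F.tr htop.ge, ?_, ?_⟩
    · rw [hfac x {0} (by decide) hx0, hG₁ x le_rfl]
      ext v
      simp
    · rw [hfac y {1} (by decide) hy1, hG₂ y le_rfl]
      ext v
      simp
  · have h := hlim.hom_ext (W := ModuleCat.of 𝕜 𝕜)
      (f := ModuleCat.ofHom (g ∘ₗ F.tr htop.le)) (f' := ModuleCat.ofHom (g' ∘ₗ F.tr htop.le)) (by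
      intro U
      refine ModuleCat.hom_ext (LinearMap.ext fun (v : F.obj ((squareCube x y).obj U.1)) => ?_)
      have hUt : (squareCube x y).obj U.1 ≤ (squareCube x y).obj Finset.univ :=
        leOfHom ((squareCube x y).map (homOfLE U.2.2.le))
      change g (F.tr htop.le (F.tr hUt v)) = g' (F.tr htop.le (F.tr hUt v))
      rcases squareCube_le_of_ne_univ x y U.1 U.2.2 with hU | hU
      · have := LinearMap.congr_fun h₁ (F.tr hU v)
        simpa using this
      · have := LinearMap.congr_fun h₂ (F.tr hU v)
        simpa using this)
    ext v
    have := LinearMap.congr_fun (congrArg ModuleCat.Hom.hom h) (F.tr htop.ge v)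
    change g (F.tr htop.le (F.tr htop.ge v)) = g' (F.tr htop.le (F.tr htop.ge v)) at this
    simpa using this

/-- A functor of degree one takes the square spanned by `x` and `y` to a pullback. -/
theorem isPullbackSquare_of_isDegree (F : PersistenceModule 𝕜 P) (hF : IsDegree 1 F)
    {p x y q : P} (hpx : p ≤ x) (hpy : p ≤ y) (hxq : x ≤ q) (hyq : y ≤ q)
    (hp : x ⊓ y = p) (hq : x ⊔ y = q) : F.IsPullbackSquare hpx hpy hxq hyq := by
  classical
  obtain ⟨hlim⟩ := hF _ (squareCube_isStronglyBicartesian x y)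
  have hbot : (squareCube x y).obj ∅ = p := by simp [squareCube_obj, hp]
  have hx0 : x = (squareCube x y).obj {0} := by simp [squareCube_obj]
  have hy1 : y = (squareCube x y).obj {1} := by simp [squareCube_obj]
  refine ⟨fun u v huv => ?_, fun w w' h₁ h₂ => ?_⟩
  · let E : ∀ z, F.obj z := fun z =>
      if h : x ≤ z then F.tr h u else if h : y ≤ z then F.tr h v else 0
    have hE₁ : ∀ z (h : x ≤ z), E z = F.tr h u := fun z h => dif_pos h
    have hE₂ : ∀ z (h : y ≤ z), E z = F.tr h v := by
      intro z h
      by_cases hx : x ≤ z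
      · rw [hE₁ z hx]
        have hz : q ≤ z := hq ▸ sup_le hx h
        simpa using congrArg (F.tr hz) huv
      · simp [E, hx, h]
    have hE : ∀ z z' (h : z ≤ z'), x ≤ z ∨ y ≤ z → F.tr h (E z) = E z' := by
      rintro z z' h (h' | h')
      · rw [hE₁ z h', hE₁ z' (h'.trans h), tr_tr]
      · rw [hE₂ z h', hE₂ z' (h'.trans h), tr_tr]
    let s : Cone (Cube.upperFace (squareCube x y ⋙ F) ∅ Finset.univ) :=
      { pt := ModuleCat.of 𝕜 𝕜
        π :=
          { app := fun U => ModuleCat.ofHom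
              (LinearMap.toSpanSingleton 𝕜 _ (E ((squareCube x y).obj U.1)))
            naturality := fun U V f => ModuleCat.hom_ext (LinearMap.ext_ring (by
              have h := hE _ _ (leOfHom ((squareCube x y).map (homOfLE (leOfHom f))))
                (le_squareCube_of_ne_empty x y U.1 U.2.1)
              change (1 : 𝕜) • E ((squareCube x y).obj V.1) =
                F.tr _ ((1 : 𝕜) • E ((squareCube x y).obj U.1))
              rw [one_smul, one_smul]
              exact h.symm)) } }
    have hfac : ∀ (z : P) (U : Finset (Fin 2)) (hU : ∅ < U)
        (hz : z = (squareCube x y).obj U) (hpz : p ≤ z),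
        F.tr hpz (F.tr hbot.le ((hlim.lift s).hom (1 : 𝕜))) = E z := by
      rintro _ U hU rfl hpz
      have := congrArg (fun g => ModuleCat.Hom.hom g (1 : 𝕜)) (hlim.fac s ⟨U, hU, by simp⟩)
      change _ = (1 : 𝕜) • E ((squareCube x y).obj U) at this
      rw [one_smul] at this
      rw [← this]
      exact F.tr_tr _ _ _
    refine ⟨F.tr hbot.le ((hlim.lift s).hom (1 : 𝕜)), ?_, ?_⟩
    · rw [hfac x {0} (by decide) hx0, hE₁ x le_rfl, tr_refl]
    · rw [hfac y {1} (by decide) hy1, hE₂ y le_rfl, tr_refl]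
  · have h := hlim.hom_ext (W := ModuleCat.of 𝕜 𝕜)
      (f := ModuleCat.ofHom (LinearMap.toSpanSingleton 𝕜 _ (F.tr hbot.ge w)))
      (f' := ModuleCat.ofHom (LinearMap.toSpanSingleton 𝕜 _ (F.tr hbot.ge w'))) (by
      intro U
      refine ModuleCat.hom_ext (LinearMap.ext_ring ?_)
      have hUt : (squareCube x y).obj ∅ ≤ (squareCube x y).obj U.1 :=
        leOfHom ((squareCube x y).map (homOfLE U.2.1.le))
      change F.tr hUt ((1 : 𝕜) • F.tr hbot.ge w) = F.tr hUt ((1 : 𝕜) • F.tr hbot.ge w')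
      rcases le_squareCube_of_ne_empty x y U.1 U.2.1 with hU | hU
      · simpa using congrArg (F.tr hU) h₁
      · simpa using congrArg (F.tr hU) h₂)
    have := LinearMap.congr_fun (congrArg ModuleCat.Hom.hom h) (1 : 𝕜)
    change (1 : 𝕜) • F.tr hbot.ge w = (1 : 𝕜) • F.tr hbot.ge w' at this
    rw [one_smul, one_smul] at this
    simpa using congrArg (F.tr hbot.le) this

end Lattice

end PersistenceModule

/-! ### Block summands over a product of chains -/

namespace PersistenceModule

variable {𝕜 : Type u} [Field 𝕜] {α β : Type w} [LinearOrder α] [LinearOrder β]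

/-- The restriction of a module over a product to a line. -/
def restrictFst (M : PersistenceModule 𝕜 (α × β)) (b : β) : PersistenceModule 𝕜 α :=
  M.comap (f := fun a => (a, b)) fun _ _ h => Prod.mk_le_mk.2 ⟨h, le_rfl⟩

/-- The module with the two coordinates exchanged. -/
def swap (M : PersistenceModule 𝕜 (α × β)) : PersistenceModule 𝕜 (β × α) :=
  M.comap (f := Prod.swap) fun _ _ h => Prod.swap_le_swap.2 h

theorem HasIntervalSummand.of_swap {M : PersistenceModule 𝕜 (α × β)} {I : Set β} {J : Set α}
    (h : M.swap.HasIntervalSummand (I ×ˢ J)) : M.HasIntervalSummand (J ×ˢ I) := by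
  obtain ⟨e, φ, he₀, hφ₀, hφe, he, hφ⟩ := h
  have hmem : ∀ x : α × β, x ∈ J ×ˢ I ↔ x.swap ∈ I ×ˢ J := fun x => and_comm
  exact ⟨fun x => e x.swap, fun x => φ x.swap, fun x hx => he₀ _ (by rwa [← hmem]),
    fun x hx => hφ₀ _ (by rwa [← hmem]), fun x hx => hφe _ ((hmem x).1 hx),
    fun x y h hx => he _ _ (Prod.swap_le_swap.2 h) ((hmem x).1 hx),
    fun x y h hy => hφ _ _ (Prod.swap_le_swap.2 h) ((hmem y).1 hy)⟩

section Pushout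

variable [OrderBot α] [OrderBot β]

/-- The squares based on the two lower axes are pushouts. -/
def IsAxesPushout (M : PersistenceModule 𝕜 (α × β)) : Prop :=
  ∀ (a : α) (b : β), M.IsPushoutSquare (p := (⊥, ⊥)) (x := (a, ⊥)) (y := (⊥, b)) (q := (a, b))
    ⟨bot_le, le_rfl⟩ ⟨le_rfl, bot_le⟩ ⟨le_rfl, bot_le⟩ ⟨bot_le, le_rfl⟩

theorem IsAxesPushout.swap {M : PersistenceModule 𝕜 (α × β)} (h : M.IsAxesPushout) :
    M.swap.IsAxesPushout := fun b a =>
  ⟨fun g₁ g₂ hg => ((h a b).1 g₂ g₁ hg.symm).imp fun _ hg => hg.symm,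
    fun g g' h₁ h₂ => (h a b).2 g g' h₂ h₁⟩

theorem IsAxesPushout.exists_deathBlock {M : PersistenceModule 𝕜 (α × β)} (hM : M.IsPFD)
    (h : M.IsAxesPushout) [Nontrivial (M.stalk (⊥, ⊥))] :
    ∃ (J₁ : Set α) (J₂ : Set β), IsLowerSet J₁ ∧ IsLowerSet J₂ ∧ ⊥ ∈ J₁ ∧ ⊥ ∈ J₂ ∧
      M.HasIntervalSummand (J₁ ×ˢ J₂) := by
  have := hM (⊥, ⊥)
  have ha : ∀ a : α, ((⊥, ⊥) : α × β) ≤ (a, ⊥) := fun a => ⟨bot_le, le_rfl⟩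
  have hb : ∀ b : β, ((⊥, ⊥) : α × β) ≤ (⊥, b) := fun b => ⟨le_rfl, bot_le⟩
  have hbot : ∀ x : α × β, (⊥, ⊥) ≤ x := fun x => ⟨bot_le, bot_le⟩
  have hmono₁ : ∀ a a', a ≤ a' → LinearMap.ker (M.tr (ha a)) ≤ LinearMap.ker (M.tr (ha a')) :=
    fun a a' h => M.ker_tr_mono _ _ (Prod.mk_le_mk.2 ⟨h, le_rfl⟩)
  have hmono₂ : ∀ b b', b ≤ b' → LinearMap.ker (M.tr (hb b)) ≤ LinearMap.ker (M.tr (hb b')) :=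
    fun b b' h => M.ker_tr_mono _ _ (Prod.mk_le_mk.2 ⟨le_rfl, h⟩)
  obtain ⟨e, φ, hφe, hker₁, hker₂⟩ := exists_vector_functional_of_chains
    (Set.range fun a => LinearMap.ker (M.tr (ha a)))
    (Set.range fun b => LinearMap.ker (M.tr (hb b)))
    (by
      rintro _ ⟨a, rfl⟩ _ ⟨b, rfl⟩ -
      exact (le_total a b).imp (hmono₁ _ _) (hmono₁ _ _))
    (by
      rintro _ ⟨a, rfl⟩ _ ⟨b, rfl⟩ -
      exact (le_total a b).imp (hmono₂ _ _) (hmono₂ _ _))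
  have he : e ≠ 0 := by
    rintro rfl
    simp at hφe
  let J₁ : Set α := {a | e ∉ LinearMap.ker (M.tr (ha a))}
  let J₂ : Set β := {b | e ∉ LinearMap.ker (M.tr (hb b))}
  have hJ₁ : IsLowerSet J₁ := fun a a' haa' h h' => h (hmono₁ _ _ haa' h')
  have hJ₂ : IsLowerSet J₂ := fun a a' haa' h h' => h (hmono₂ _ _ haa' h')
  have hbot₁ : ⊥ ∈ J₁ := by simpa [J₁] using he
  have hbot₂ : ⊥ ∈ J₂ := by simpa [J₂] using he
  obtain ⟨Φ, hΦ, hΦ₀, hΦtr⟩ := M.exists_compatible_functionals_on (J₁ ×ˢ J₂) (x := (⊥, ⊥))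
    (by
      rintro ⟨a, b⟩ ⟨h₁, h₂⟩ ⟨a', b'⟩ ⟨h₁', h₂'⟩
      refine ⟨(max a a', max b b'), ⟨?_, ?_⟩, ⟨le_max_left _ _, le_max_left _ _⟩,
        ⟨le_max_right _ _, le_max_right _ _⟩⟩
      · change max a a' ∈ J₁
        rcases max_choice a a' with h | h <;> rwa [h]
      · change max b b' ∈ J₂
        rcases max_choice b b' with h | h <;> rwa [h])
    ⟨hbot₁, hbot₂⟩ φ (by
      rintro ⟨a, b⟩ ⟨h₁, h₂⟩ hle
      obtain ⟨g₁, hg₁⟩ := LinearMap.exists_comp_eq_of_ker_le (M.tr (ha a)) φ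
        ((hker₁ _ ⟨a, rfl⟩).resolve_left h₁)
      obtain ⟨g₂, hg₂⟩ := LinearMap.exists_comp_eq_of_ker_le (M.tr (hb b)) φ
        ((hker₂ _ ⟨b, rfl⟩).resolve_left h₂)
      obtain ⟨g, hg, -⟩ := (h a b).1 g₁ g₂ (hg₁.trans hg₂.symm)
      intro v hv
      rw [LinearMap.mem_ker, ← hg₁, ← hg]
      have := congrArg g (LinearMap.mem_ker.1 hv)
      simpa using this)
  have hmem : ∀ x y : α × β, x ≤ y → y ∈ J₁ ×ˢ J₂ → x ∈ J₁ ×ˢ J₂ :=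
    fun x y hxy hy => ⟨hJ₁ hxy.1 hy.1, hJ₂ hxy.2 hy.2⟩
  refine ⟨J₁, J₂, hJ₁, hJ₂, hbot₁, hbot₂, fun x => M.tr (hbot x) e, Φ, ?_, hΦ₀, ?_, ?_, ?_⟩
  · rintro ⟨a, b⟩ hx
    rcases not_and_or.1 hx with hx | hx
    · have h1 : M.tr (ha a) e = 0 := not_not.1 hx
      have := congrArg (M.tr (show ((a, ⊥) : α × β) ≤ (a, b) from ⟨le_rfl, bot_le⟩)) h1
      simpa using this
    · have h1 : M.tr (hb b) e = 0 := not_not.1 hx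
      have := congrArg (M.tr (show ((⊥, b) : α × β) ≤ (a, b) from ⟨bot_le, le_rfl⟩)) h1
      simpa using this
  · intro x hx
    have := LinearMap.congr_fun (hΦtr (⊥, ⊥) (Set.mk_mem_prod hbot₁ hbot₂) x hx (hbot x)) e
    rwa [hΦ, hφe] at this
  · intro x y hxy _
    simp
  · intro x y hxy hy
    exact hΦtr x (hmem x y hxy hy) y hy hxy

theorem IsAxesPushout.exists_verticalBlock {M : PersistenceModule 𝕜 (α × β)} (hM : M.IsPFD)
    (h : M.IsAxesPushout) [Subsingleton (M.stalk (⊥, ⊥))] (a : α) [Nontrivial (M.stalk (a, ⊥))] :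
    ∃ J : Set α, IsPosetInterval J ∧ M.HasIntervalSummand (J ×ˢ (Set.univ : Set β)) := by
  have hbot : ∀ (a : α) (b : β), ((a, ⊥) : α × β) ≤ (a, b) := fun a b => ⟨le_rfl, bot_le⟩
  have hbot' : ∀ (a : α) (b : β), ((⊥, b) : α × β) ≤ (a, b) := fun a b => ⟨bot_le, le_rfl⟩
  have : Nontrivial ((M.restrictFst ⊥).stalk a) := inferInstanceAs (Nontrivial (M.stalk (a, ⊥)))
  obtain ⟨J, hJ, e, φ, he₀, hφ₀, hφe, he, hφ⟩ :=
    (M.restrictFst ⊥).exists_intervalSummand_of_linearOrder (fun a => hM (a, ⊥)) a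
  let e : ∀ a, M.stalk (a, ⊥) := e
  let φ : ∀ a, M.stalk (a, ⊥) →ₗ[𝕜] 𝕜 := φ
  have hex : ∀ (x : α × β), ∃ g : M.stalk x →ₗ[𝕜] 𝕜,
      g ∘ₗ M.tr (hbot x.1 x.2) = φ x.1 ∧ g ∘ₗ M.tr (hbot' x.1 x.2) = 0 := fun x =>
    (h x.1 x.2).1 (φ x.1) 0 (by
      ext v
      rw [Subsingleton.elim v 0]
      simp)
  choose Φ hΦ₁ hΦ₂ using hex
  refine ⟨J, hJ, fun x => M.tr (hbot x.1 x.2) (e x.1), Φ, ?_, ?_, ?_, ?_, ?_⟩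
  · intro x hx
    have h1 : e x.1 = 0 := he₀ x.1 fun hx' => hx ⟨hx', trivial⟩
    simp [h1]
  · intro x hx
    have h1 : φ x.1 = 0 := hφ₀ x.1 fun hx' => hx ⟨hx', trivial⟩
    refine (h x.1 x.2).2 _ _ ?_ ?_
    · exact (hΦ₁ x).trans (by simp [h1])
    · exact (hΦ₂ x).trans (by simp)
  · intro x hx
    exact (LinearMap.congr_fun (hΦ₁ x) (e x.1)).trans (hφe x.1 hx.1)
  · intro x y hxy hx
    have h1 : M.tr (show (x.1, ⊥) ≤ (y.1, ⊥) from ⟨hxy.1, le_rfl⟩) (e x.1) = e y.1 :=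
      he x.1 y.1 hxy.1 hx.1
    beta_reduce
    rw [← h1, tr_tr]
    exact (M.tr_tr _ _ _).symm
  · intro x y hxy hy
    have h1 : φ y.1 ∘ₗ M.tr (show (x.1, ⊥) ≤ (y.1, ⊥) from ⟨hxy.1, le_rfl⟩) = φ x.1 :=
      hφ x.1 y.1 hxy.1 hy.1
    refine (h x.1 x.2).2 _ _ ?_ ?_
    · refine Eq.trans ?_ (hΦ₁ x).symm
      rw [← h1, ← hΦ₁ y]
      ext v
      simp
    · refine Eq.trans ?_ (hΦ₂ x).symm
      ext v
      have := LinearMap.congr_fun (hΦ₂ y)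
        (M.tr (show (⊥, x.2) ≤ (⊥, y.2) from ⟨le_rfl, hxy.2⟩) v)
      simpa using this

theorem IsAxesPushout.exists_blockSummand {M : PersistenceModule 𝕜 (α × β)} (hM : M.IsPFD)
    (h : M.IsAxesPushout) (x : α × β) (hx : Nontrivial (M.stalk x)) :
    (∃ (J₁ : Set α) (J₂ : Set β), IsLowerSet J₁ ∧ IsLowerSet J₂ ∧ ⊥ ∈ J₁ ∧ ⊥ ∈ J₂ ∧
      M.HasIntervalSummand (J₁ ×ˢ J₂)) ∨
    (∃ J : Set α, IsPosetInterval J ∧ M.HasIntervalSummand (J ×ˢ (Set.univ : Set β))) ∨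
    ∃ J : Set β, IsPosetInterval J ∧ M.HasIntervalSummand ((Set.univ : Set α) ×ˢ J) := by
  rcases subsingleton_or_nontrivial (M.stalk (⊥, ⊥)) with h0 | h0
  · right
    rcases subsingleton_or_nontrivial (M.stalk (x.1, ⊥)) with h1 | h1
    · rcases subsingleton_or_nontrivial (M.stalk (⊥, x.2)) with h2 | h2
      · exfalso
        have hdual : ∀ g g' : M.stalk x →ₗ[𝕜] 𝕜, g = g' := fun g g' =>
          (h x.1 x.2).2 g g' (Subsingleton.elim _ _) (Subsingleton.elim _ _)
        obtain ⟨v, hv⟩ := exists_ne (0 : M.stalk x)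
        obtain ⟨f, hf⟩ := Module.Projective.exists_dual_ne_zero 𝕜 hv
        exact hf (by simp [hdual f 0])
      · right
        have : Subsingleton (M.swap.stalk (⊥, ⊥)) := h0
        have : Nontrivial (M.swap.stalk (x.2, ⊥)) := h2
        obtain ⟨J, hJ, hJ'⟩ := IsAxesPushout.exists_verticalBlock (M := M.swap)
          (fun x => hM x.swap) h.swap x.2
        exact ⟨J, hJ, hJ'.of_swap⟩
    · left
      exact h.exists_verticalBlock hM x.1
  · left
    exact h.exists_deathBlock hM

end Pushout

section Pullback

variable [OrderTop α] [OrderTop β]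

/-- The squares based on the two upper axes are pullbacks. -/
def IsAxesPullback (M : PersistenceModule 𝕜 (α × β)) : Prop :=
  ∀ (a : α) (b : β), M.IsPullbackSquare (p := (a, b)) (x := (a, ⊤)) (y := (⊤, b)) (q := (⊤, ⊤))
    ⟨le_rfl, le_top⟩ ⟨le_top, le_rfl⟩ ⟨le_top, le_rfl⟩ ⟨le_rfl, le_top⟩

theorem IsAxesPullback.swap {M : PersistenceModule 𝕜 (α × β)} (h : M.IsAxesPullback) :
    M.swap.IsAxesPullback := fun b a =>
  ⟨fun u v huv => ((h a b).1 v u huv.symm).imp fun _ hw => hw.symm,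
    fun w w' h₁ h₂ => (h a b).2 w w' h₂ h₁⟩

theorem IsAxesPullback.exists_birthBlock {M : PersistenceModule 𝕜 (α × β)} (hM : M.IsPFD)
    (h : M.IsAxesPullback) [Nontrivial (M.stalk (⊤, ⊤))] :
    ∃ (J₁ : Set α) (J₂ : Set β), IsUpperSet J₁ ∧ IsUpperSet J₂ ∧ ⊤ ∈ J₁ ∧ ⊤ ∈ J₂ ∧
      M.HasIntervalSummand (J₁ ×ˢ J₂) := by
  have := hM (⊤, ⊤)
  have ha : ∀ a : α, ((a, ⊤) : α × β) ≤ (⊤, ⊤) := fun a => ⟨le_top, le_rfl⟩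
  have hb : ∀ b : β, ((⊤, b) : α × β) ≤ (⊤, ⊤) := fun b => ⟨le_rfl, le_top⟩
  have htop : ∀ x : α × β, x ≤ (⊤, ⊤) := fun x => ⟨le_top, le_top⟩
  have hmono₁ : ∀ a a', a ≤ a' →
      LinearMap.range (M.tr (ha a)) ≤ LinearMap.range (M.tr (ha a')) :=
    fun a a' h => M.range_tr_mono _ _ (Prod.mk_le_mk.2 ⟨h, le_rfl⟩)
  have hmono₂ : ∀ b b', b ≤ b' →
      LinearMap.range (M.tr (hb b)) ≤ LinearMap.range (M.tr (hb b')) :=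
    fun b b' h => M.range_tr_mono _ _ (Prod.mk_le_mk.2 ⟨le_rfl, h⟩)
  obtain ⟨e, φ, hφe, hrange₁, hrange₂⟩ := exists_vector_functional_of_chains
    (Set.range fun a => LinearMap.range (M.tr (ha a)))
    (Set.range fun b => LinearMap.range (M.tr (hb b)))
    (by
      rintro _ ⟨a, rfl⟩ _ ⟨b, rfl⟩ -
      exact (le_total a b).imp (hmono₁ _ _) (hmono₁ _ _))
    (by
      rintro _ ⟨a, rfl⟩ _ ⟨b, rfl⟩ -
      exact (le_total a b).imp (hmono₂ _ _) (hmono₂ _ _))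
  let J₁ : Set α := {a | e ∈ LinearMap.range (M.tr (ha a))}
  let J₂ : Set β := {b | e ∈ LinearMap.range (M.tr (hb b))}
  have hJ₁ : IsUpperSet J₁ := fun a a' haa' h => hmono₁ _ _ haa' h
  have hJ₂ : IsUpperSet J₂ := fun a a' haa' h => hmono₂ _ _ haa' h
  have htop₁ : ⊤ ∈ J₁ := ⟨e, by simp⟩
  have htop₂ : ⊤ ∈ J₂ := ⟨e, by simp⟩
  obtain ⟨E, hE, hE₀, hEtr⟩ := M.exists_compatible_lifts_on hM (J₁ ×ˢ J₂) (x := (⊤, ⊤))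
    (by
      rintro ⟨a, b⟩ ⟨h₁, h₂⟩ ⟨a', b'⟩ ⟨h₁', h₂'⟩
      refine ⟨(min a a', min b b'), ⟨?_, ?_⟩, ⟨min_le_left _ _, min_le_left _ _⟩,
        ⟨min_le_right _ _, min_le_right _ _⟩⟩
      · change min a a' ∈ J₁
        rcases min_choice a a' with h | h <;> rwa [h]
      · change min b b' ∈ J₂
        rcases min_choice b b' with h | h <;> rwa [h])
    ⟨htop₁, htop₂⟩ e (by
      rintro ⟨a, b⟩ ⟨⟨u, hu⟩, ⟨v, hv⟩⟩ hle
      obtain ⟨w, hw, -⟩ := (h a b).1 u v (hu.trans hv.symm)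
      refine ⟨w, ?_⟩
      rw [← hu, ← hw, tr_tr])
  have hmem : ∀ x y : α × β, x ≤ y → x ∈ J₁ ×ˢ J₂ → y ∈ J₁ ×ˢ J₂ :=
    fun x y hxy hx => ⟨hJ₁ hxy.1 hx.1, hJ₂ hxy.2 hx.2⟩
  refine ⟨J₁, J₂, hJ₁, hJ₂, htop₁, htop₂, E, fun x => φ ∘ₗ M.tr (htop x), hE₀, ?_, ?_, ?_, ?_⟩
  · rintro ⟨a, b⟩ hx
    ext v
    rcases not_and_or.1 hx with hx | hx
    · have h1 := (hrange₁ _ ⟨a, rfl⟩).resolve_left hx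
        ⟨M.tr (show ((a, b) : α × β) ≤ (a, ⊤) from ⟨le_rfl, le_top⟩) v, rfl⟩
      simpa using h1
    · have h1 := (hrange₂ _ ⟨b, rfl⟩).resolve_left hx
        ⟨M.tr (show ((a, b) : α × β) ≤ (⊤, b) from ⟨le_top, le_rfl⟩) v, rfl⟩
      simpa using h1
  · intro x hx
    have := hEtr x hx (⊤, ⊤) (Set.mk_mem_prod htop₁ htop₂) (htop x)
    simp [this, hE, hφe]
  · intro x y hxy hx
    exact hEtr x hx y (hmem x y hxy hx) hxy
  · intro x y hxy _
    ext v
    simp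

theorem IsAxesPullback.exists_verticalBlock {M : PersistenceModule 𝕜 (α × β)} (hM : M.IsPFD)
    (h : M.IsAxesPullback) [Subsingleton (M.stalk (⊤, ⊤))] (a : α) [Nontrivial (M.stalk (a, ⊤))] :
    ∃ J : Set α, IsPosetInterval J ∧ M.HasIntervalSummand (J ×ˢ (Set.univ : Set β)) := by
  have htop : ∀ (a : α) (b : β), ((a, b) : α × β) ≤ (a, ⊤) := fun a b => ⟨le_rfl, le_top⟩
  have htop' : ∀ (a : α) (b : β), ((a, b) : α × β) ≤ (⊤, b) := fun a b => ⟨le_top, le_rfl⟩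
  have : Nontrivial ((M.restrictFst ⊤).stalk a) := inferInstanceAs (Nontrivial (M.stalk (a, ⊤)))
  obtain ⟨J, hJ, e, φ, he₀, hφ₀, hφe, he, hφ⟩ :=
    (M.restrictFst ⊤).exists_intervalSummand_of_linearOrder (fun a => hM (a, ⊤)) a
  let e : ∀ a, M.stalk (a, ⊤) := e
  let φ : ∀ a, M.stalk (a, ⊤) →ₗ[𝕜] 𝕜 := φ
  have hex : ∀ (x : α × β), ∃ w : M.stalk x,
      M.tr (htop x.1 x.2) w = e x.1 ∧ M.tr (htop' x.1 x.2) w = 0 := fun x =>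
    (h x.1 x.2).1 (e x.1) 0 (Subsingleton.elim _ _)
  choose E hE₁ hE₂ using hex
  refine ⟨J, hJ, E, fun x => φ x.1 ∘ₗ M.tr (htop x.1 x.2), ?_, ?_, ?_, ?_, ?_⟩
  · intro x hx
    have h1 : e x.1 = 0 := he₀ x.1 fun hx' => hx ⟨hx', trivial⟩
    refine (h x.1 x.2).2 _ _ ?_ ?_
    · exact (hE₁ x).trans (by simp [h1])
    · exact (hE₂ x).trans (by simp)
  · intro x hx
    have h1 : φ x.1 = 0 := hφ₀ x.1 fun hx' => hx ⟨hx', trivial⟩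
    simp [h1]
  · intro x hx
    exact (congrArg (φ x.1) (hE₁ x)).trans (hφe x.1 hx.1)
  · intro x y hxy hx
    have h1 : M.tr (show (x.1, ⊤) ≤ (y.1, ⊤) from ⟨hxy.1, le_rfl⟩) (e x.1) = e y.1 :=
      he x.1 y.1 hxy.1 hx.1
    refine (h y.1 y.2).2 _ _ ?_ ?_
    · refine Eq.trans ?_ (hE₁ y).symm
      rw [← h1, ← hE₁ x, tr_tr]
      exact (M.tr_tr _ _ _).symm
    · refine Eq.trans ?_ (hE₂ y).symm
      have := congrArg (M.tr (show (⊤, x.2) ≤ (⊤, y.2) from ⟨le_rfl, hxy.2⟩)) (hE₂ x)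
      rw [tr_tr, map_zero] at this
      exact (M.tr_tr _ _ _).trans this
  · intro x y hxy hy
    have h1 : φ y.1 ∘ₗ M.tr (show (x.1, ⊤) ≤ (y.1, ⊤) from ⟨hxy.1, le_rfl⟩) = φ x.1 :=
      hφ x.1 y.1 hxy.1 hy.1
    beta_reduce
    rw [← h1]
    ext v
    simp

theorem IsAxesPullback.exists_blockSummand {M : PersistenceModule 𝕜 (α × β)} (hM : M.IsPFD)
    (h : M.IsAxesPullback) (x : α × β) (hx : Nontrivial (M.stalk x)) :
    (∃ (J₁ : Set α) (J₂ : Set β), IsUpperSet J₁ ∧ IsUpperSet J₂ ∧ ⊤ ∈ J₁ ∧ ⊤ ∈ J₂ ∧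
      M.HasIntervalSummand (J₁ ×ˢ J₂)) ∨
    (∃ J : Set α, IsPosetInterval J ∧ M.HasIntervalSummand (J ×ˢ (Set.univ : Set β))) ∨
    ∃ J : Set β, IsPosetInterval J ∧ M.HasIntervalSummand ((Set.univ : Set α) ×ˢ J) := by
  rcases subsingleton_or_nontrivial (M.stalk (⊤, ⊤)) with h0 | h0
  · right
    rcases subsingleton_or_nontrivial (M.stalk (x.1, ⊤)) with h1 | h1
    · rcases subsingleton_or_nontrivial (M.stalk (⊤, x.2)) with h2 | h2
      · exfalso
        obtain ⟨v, hv⟩ := exists_ne (0 : M.stalk x)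
        exact hv ((h x.1 x.2).2 v 0 (Subsingleton.elim _ _) (Subsingleton.elim _ _))
      · right
        have : Subsingleton (M.swap.stalk (⊤, ⊤)) := h0
        have : Nontrivial (M.swap.stalk (x.2, ⊤)) := h2
        obtain ⟨J, hJ, hJ'⟩ := IsAxesPullback.exists_verticalBlock (M := M.swap)
          (fun x => hM x.swap) h.swap x.2
        exact ⟨J, hJ, hJ'.of_swap⟩
    · left
      exact h.exists_verticalBlock hM x.1
  · left
    exact h.exists_birthBlock hM

end Pullback

end PersistenceModule

/-! ### Blocks are intervals -/

section Blocks

variable {P Q : Type*} [PartialOrder P] [PartialOrder Q]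

theorem IsPosetInterval.of_isLowerSet [OrderBot P] {I : Set P} (hI : IsLowerSet I)
    (hbot : ⊥ ∈ I) : IsPosetInterval I where
  nonempty := ⟨⊥, hbot⟩
  convex _ _ _ _ hy _ hzy := hI hzy hy
  connected _ _ hx hy := .head ⟨hx, hbot, Or.inr bot_le⟩ (.single ⟨hbot, hy, Or.inl bot_le⟩)

theorem IsPosetInterval.of_isUpperSet [OrderTop P] {I : Set P} (hI : IsUpperSet I)
    (htop : ⊤ ∈ I) : IsPosetInterval I where
  nonempty := ⟨⊤, htop⟩
  convex _ _ _ hx _ hxz _ := hI hxz hx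
  connected _ _ hx hy := .head ⟨hx, htop, Or.inl le_top⟩ (.single ⟨htop, hy, Or.inr le_top⟩)

theorem IsPosetInterval.prod {I : Set P} {J : Set Q} (hI : IsPosetInterval I)
    (hJ : IsPosetInterval J) : IsPosetInterval (I ×ˢ J) where
  nonempty := hI.nonempty.prod hJ.nonempty
  convex _ _ _ hx hy hxz hzy :=
    ⟨hI.convex hx.1 hy.1 hxz.1 hzy.1, hJ.convex hx.2 hy.2 hxz.2 hzy.2⟩
  connected := by
    rintro ⟨a, b⟩ ⟨a', b'⟩ ⟨ha, hb⟩ ⟨ha', hb'⟩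
    refine .trans (b := (a', b)) ?_ ?_
    · exact (hI.connected ha ha').lift (fun t => (t, b)) fun s t ⟨hs, ht, hst⟩ =>
        ⟨⟨hs, hb⟩, ⟨ht, hb⟩, hst.imp (fun h => ⟨h, le_rfl⟩) fun h => ⟨h, le_rfl⟩⟩
    · exact (hJ.connected hb hb').lift (fun t => (a', t)) fun s t ⟨hs, ht, hst⟩ =>
        ⟨⟨ha', hs⟩, ⟨ha', ht⟩, hst.imp (fun h => ⟨le_rfl, h⟩) fun h => ⟨le_rfl, h⟩⟩

theorem isPosetInterval_univ [OrderBot P] : IsPosetInterval (Set.univ : Set P) :=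
  .of_isLowerSet isLowerSet_univ trivial

end Blocks

theorem mainTheorem2 (𝕜 : Type u) [Field 𝕜] (F : PersistenceModule 𝕜 (ℝ≥0∞ × ℝ≥0∞))
    (hF : F.IsPFD) :
    (IsCodegree 1 F → F.IsIntervalDecomposableOver
      (fun I => IsDeathBlock I ∨ IsVerticalBlock I ∨ IsHorizontalBlock I)) ∧
    (IsDegree 1 F → F.IsIntervalDecomposableOver
      (fun I => IsBirthBlock I ∨ IsVerticalBlock I ∨ IsHorizontalBlock I)) := by
  refine ⟨fun h => ?_, fun h => ?_⟩
  · refine PersistenceModule.isIntervalDecomposableOver_of_summands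
      PersistenceModule.IsAxesPushout (fun i r hir hN a b => (hN a b).of_retract i r hir) _
      (by rintro I (h | h | h) <;> exact h.1) ?_ F hF
      (fun a b => F.isPushoutSquare_of_isCodegree h _ _ _ _ (by simp) (by simp))
    intro M hM hQ x hx
    rcases hQ.exists_blockSummand hM x hx with ⟨J₁, J₂, h₁, h₂, hb₁, hb₂, h⟩ | ⟨J, hJ, h⟩ |
      ⟨J, hJ, h⟩
    · exact ⟨_, Or.inl ⟨(IsPosetInterval.of_isLowerSet h₁ hb₁).prod (.of_isLowerSet h₂ hb₂),
        J₁, J₂, h₁, h₂, rfl⟩, h⟩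
    · exact ⟨_, Or.inr (Or.inl ⟨hJ.prod isPosetInterval_univ, J, hJ, rfl⟩), h⟩
    · exact ⟨_, Or.inr (Or.inr ⟨isPosetInterval_univ.prod hJ, J, hJ, rfl⟩), h⟩
  · refine PersistenceModule.isIntervalDecomposableOver_of_summands
      PersistenceModule.IsAxesPullback (fun i r hir hN a b => (hN a b).of_retract i r hir) _
      (by rintro I (h | h | h) <;> exact h.1) ?_ F hF
      (fun a b => F.isPullbackSquare_of_isDegree h _ _ _ _ (by simp) (by simp))
    intro M hM hQ x hx
    rcases hQ.exists_blockSummand hM x hx with ⟨J₁, J₂, h₁, h₂, hb₁, hb₂, h⟩ | ⟨J, hJ, h⟩ |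
      ⟨J, hJ, h⟩
    · exact ⟨_, Or.inl ⟨(IsPosetInterval.of_isUpperSet h₁ hb₁).prod (.of_isUpperSet h₂ hb₂),
        J₁, J₂, h₁, h₂, rfl⟩, h⟩
    · exact ⟨_, Or.inr (Or.inl ⟨hJ.prod isPosetInterval_univ, J, hJ, rfl⟩), h⟩
    · exact ⟨_, Or.inr (Or.inr ⟨isPosetInterval_univ.prod hJ, J, hJ, rfl⟩), h⟩
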